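/- An $r$-graph is an $r$-uniform hypergraph (without repeated edges). A (Berge) cycle of length $k \ge 2$ in a hypergraph is an alternating sequence of distinct vertices and distinct edges $v_1, e_1, \ldots, v_k, e_k$ such that $v_i, v_{i+1} \in e_i$ for each $i$, with indices taken modulo $k$. The girth of a hypergraph is the length of its shortest cycle, and is $\infty$ if it has no cycle. For every fixed integer $r \ge 3$, the number of $r$-graphs on $n$ labeled vertices with girth greater than $5$ is $2^{o(n^{3/2})}$ as $n \to \infty$. -/

import Mathlib

open Filter Asymptotics

namespace Hypergraph

/-- Every edge has exactly `r` vertices. -/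
def IsUniform {α : Type*} (H : Hypergraph α) (r : ℕ) : Prop :=
  ∀ e ∈ H.edgeSet, e.encard = r

/-- `H` contains a Berge cycle of length `k ≥ 2`: distinct vertices `v i` and distinct edges `e i`,
with indices modulo `k`, such that `v i` and `v (i + 1)` both lie in `e i`. -/
def HasBergeCycle {α : Type*} (H : Hypergraph α) (k : ℕ) : Prop :=
  2 ≤ k ∧ ∃ (v : ZMod k → α) (e : ZMod k → Set α),
    Function.Injective v ∧ Function.Injective e ∧
    ∀ i, e i ∈ H.edgeSet ∧ v i ∈ e i ∧ v (i + 1) ∈ e i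

/-- The length of a shortest Berge cycle; it is `⊤` if there is none. -/
noncomputable def egirth {α : Type*} (H : Hypergraph α) : ℕ∞ :=
  ⨅ (k : ℕ) (_ : H.HasBergeCycle k), (k : ℕ∞)

instance finite {α : Type*} [Finite α] : Finite (Hypergraph α) :=
  Finite.of_injective (fun H : Hypergraph α => (H.vertexSet, H.edgeSet)) fun _ _ h =>
    Hypergraph.ext (congrArg Prod.fst h) (congrArg Prod.snd h)

/-- The number of `r`-uniform hypergraphs with vertex set exactly `Fin n` (all labeled vertices,
isolated ones included) whose girth is greater than `g`. -/
noncomputable def girthCount (r g n : ℕ) : ℕ :=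
  Set.ncard {H : Hypergraph (Fin n) |
    H.vertexSet = Set.univ ∧ H.IsUniform r ∧ (g : ℕ∞) < H.egirth}

end Hypergraph

/-! Write r = k + 2 and s = √n. Order each hyperedge and, for each of its k later vertices, keep the
triple formed with the first two vertices. Girth above five forces each of the k resulting shadow
graphs to have no cycle of length four or five (`fourCycleFree_shadow`, `fiveCycleFree_shadow`). It
also forces every shadow triangle to come from a single hyperedge, so the k shadows determine the
hypergraph (`edgeSet_subset_of_shadow_eq`). It remains to count the possible shadows.

Every edge of a shadow lies in a triangle, and a graph without C4 and C5 has o(n^{3/2}) triangles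
(`exists_triangleSum_le`), so shadows have o(n^{3/2}) edges. The triangle bound is a sparse removal
argument. Codegrees at most one keep the L² energy O(n), so a bounded number of colours approximates
the graph in cut norm within η n^{3/2}. If the colour pairs of density at least ε/s spanned many
triangles, they would span many closed five-walks, and a counting lemma would give order n^{5/2}
closed five-walks in the graph; with degrees at most 2s there are only O(n²). Dense triangle removal
therefore applies to the reduced relation. The removed pairs and the sparse pairs together carry few
edges, every triangle uses one of these, and each edge lies in at most one triangle.

C4-free graphs with at most m edges number at most exp(c n^{3/2} + a m), for any c > 0 and n large
(`exists_card_fourCycleFree_le`). Vertices of minimum degree are peeled off; each peeled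
neighbourhood is independent for the relation "joined by a two-path", which is locally dense, so the
Kleitman–Winston method bounds the choices. Weighting a graph with e edges by L^{-e} costs only L^m
in the end. Taking m = o(n^{3/2}) and the k-th power gives the theorem. -/

/-! ### Weighted counting of independent sets in locally dense relations. -/

section KleitmanWinston

open scoped Classical

variable {V : Type*}

/-- The generating function, at weight `w`, of the subsets of `S` that are independent for `Γ`. -/
noncomputable def indepSum (Γ : V → V → Prop) (w : ℝ) (S : Finset V) : ℝ :=
  ∑ N ∈ S.powerset, if (N : Set V).Pairwise (fun x y => ¬ Γ x y) then w ^ N.card else 0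

/-- Split by whether v belongs to the independent set: if it does, the other members avoid the
Γ-neighbours of v. -/
theorem indepSum_le_add (Γ : V → V → Prop) {w : ℝ} (hw : 0 ≤ w) {S : Finset V} {v : V}
    (hv : v ∈ S) :
    indepSum Γ w S ≤ indepSum Γ w (S.erase v)
      + w * indepSum Γ w ((S.erase v).filter fun y => ¬ Γ v y) := by
  conv_lhs => rw [← Finset.insert_erase hv]
  unfold indepSum
  rw [Finset.sum_powerset_insert (Finset.notMem_erase v S)]
  gcongr
  rw [Finset.mul_sum]
  have hsub : ((S.erase v).filter fun y => ¬ Γ v y).powerset ⊆ (S.erase v).powerset :=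
    Finset.powerset_mono.2 (Finset.filter_subset _ _)
  rw [← Finset.sum_subset hsub (f := fun N =>
    if ((insert v N : Finset V) : Set V).Pairwise (fun x y => ¬ Γ x y)
      then w ^ (insert v N).card else 0)]
  · refine Finset.sum_le_sum fun N hN => ?_
    have hvN : v ∉ N := fun h => by
      have := Finset.mem_powerset.1 hN h
      simp at this
    split_ifs with h1 h2
    · rw [Finset.card_insert_of_notMem hvN, pow_succ']
    · exact absurd (h1.mono (by simp)) h2
    · positivity
    · simp
  · intro N hN hN'
    rw [if_neg]
    intro hp
    apply hN'
    rw [Finset.mem_powerset] at hN ⊢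
    intro y hy
    refine Finset.mem_filter.2 ⟨hN hy, ?_⟩
    have hne : v ≠ y := fun h => by
      have := hN hy
      simp [h] at this
    exact hp (by simp) (by simp [hy]) hne

theorem indepSum_le_exp (Γ : V → V → Prop) {w : ℝ} (hw : 0 ≤ w) (S : Finset V) :
    indepSum Γ w S ≤ Real.exp (w * S.card) := by
  calc indepSum Γ w S ≤ ∑ N ∈ S.powerset, w ^ N.card := by
        refine Finset.sum_le_sum fun N _ => ?_
        split_ifs
        · exact le_rfl
        · positivity
    _ = (w + 1) ^ S.card := by
        have := Finset.sum_pow_mul_eq_add_pow w 1 S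
        simpa using this
    _ ≤ (Real.exp w) ^ S.card := by
        gcongr
        exact Real.add_one_le_exp w
    _ = _ := by rw [← Real.exp_nat_mul, mul_comm]

/-- The Kleitman–Winston bound for independent sets of a locally dense graph. -/
theorem indepSum_le_of_locally_dense (Γ : V → V → Prop) (U : Finset V) {w β R : ℝ}
    (hw : 0 ≤ w) (hw1 : w ≤ 1)
    (hdense : ∀ S ⊆ U, R < S.card →
      ∃ v ∈ S, β * S.card ≤ ((S.erase v).filter fun y => Γ v y).card)
    (S : Finset V) (hSU : S ⊆ U) (q : ℕ) (hS : (S.card : ℝ) ≤ R * Real.exp (β * q)) :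
    indepSum Γ w S ≤ (1 + S.card : ℝ) ^ q * Real.exp (w * R) := by
  induction S using Finset.strongInduction generalizing q with
  | H S ih =>
    by_cases hR : (S.card : ℝ) ≤ R
    · calc indepSum Γ w S ≤ Real.exp (w * S.card) := indepSum_le_exp Γ hw S
        _ ≤ 1 * Real.exp (w * R) := by rw [one_mul]; gcongr
        _ ≤ _ := by
          gcongr
          exact one_le_pow₀ (by linarith [(Nat.cast_nonneg S.card : (0 : ℝ) ≤ _)])
    · push Not at hR
      obtain ⟨v, hv, hdeg⟩ := hdense S hSU hR
      -- Here q bounds the number of times a vertex can still be selected, since each selection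
      -- shrinks the set by a factor 1 - β. For q = 0 the size is already at most R.
      obtain _ | q := q
      · simp at hS; linarith
      have hcard : (S.erase v).card + 1 = S.card := Finset.card_erase_add_one hv
      have h1 := ih (S.erase v) (Finset.erase_ssubset hv)
        ((Finset.erase_subset _ _).trans hSU) (q + 1) (by
          have : ((S.erase v).card : ℝ) ≤ S.card := by
            exact_mod_cast Finset.card_le_card (Finset.erase_subset _ _)
          linarith)
      set S' := (S.erase v).filter fun y => ¬ Γ v y with hS'
      have hsplit : ((S.erase v).filter fun y => Γ v y).card + S'.card = (S.erase v).card :=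
        Finset.card_filter_add_card_filter_not _
      have hS'c : (S'.card : ℝ) ≤ (1 - β) * S.card := by
        have h2 : (((S.erase v).filter fun y => Γ v y).card : ℝ) + S'.card + 1 = S.card := by
          exact_mod_cast (by rw [hsplit, hcard])
        linarith
      have hS'e : (S'.card : ℝ) ≤ R * Real.exp (β * q) := by
        have h3 : (1 - β) ≤ Real.exp (-β) := Real.one_sub_le_exp_neg β
        calc (S'.card : ℝ) ≤ (1 - β) * S.card := hS'c
          _ ≤ Real.exp (-β) * S.card := by gcongr
          _ ≤ Real.exp (-β) * (R * Real.exp (β * (q + 1 : ℕ))) := by gcongr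
          _ = R * (Real.exp (-β) * Real.exp (β * (q + 1 : ℕ))) := by ring
          _ = _ := by
            rw [← Real.exp_add]
            congr 2
            push_cast; ring
      have hsub : S' ⊂ S := (Finset.filter_subset _ _).trans_ssubset (Finset.erase_ssubset hv)
      have h2 := ih S' hsub (hsub.1.trans hSU) q hS'e
      have hc' : (S'.card : ℝ) ≤ S.card := by exact_mod_cast Finset.card_le_card hsub.1
      have hcr : (1 + (S.erase v).card : ℝ) = S.card := by
        rw [add_comm]; exact_mod_cast hcard
      -- Losing exactly one vertex turns the base 1 + |S \ {v}| into |S|, and |S|^(q+1) + (1 +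
      -- |S|)^q ≤ (1 + |S|)^(q+1) closes the induction.
      rw [hcr] at h1
      have hs0 : (0 : ℝ) ≤ S.card := Nat.cast_nonneg _
      calc indepSum Γ w S ≤ _ := indepSum_le_add Γ hw hv
        _ ≤ (S.card : ℝ) ^ (q + 1) * Real.exp (w * R)
            + 1 * ((1 + S.card : ℝ) ^ q * Real.exp (w * R)) := by
          have h0 : 0 ≤ indepSum Γ w S' := Finset.sum_nonneg fun N _ => by
            split_ifs <;> positivity
          have h2' : indepSum Γ w S' ≤ (1 + S.card : ℝ) ^ q * Real.exp (w * R) := by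
            refine h2.trans ?_
            gcongr
          exact add_le_add h1 (mul_le_mul hw1 h2' h0 zero_le_one)
        _ = ((S.card : ℝ) ^ q * S.card + (1 + S.card : ℝ) ^ q) * Real.exp (w * R) := by ring
        _ ≤ ((1 + S.card : ℝ) ^ q * S.card + (1 + S.card : ℝ) ^ q) * Real.exp (w * R) := by
          gcongr
          linarith
        _ = _ := by ring

theorem card_indep_mul_pow_le (Γ : V → V → Prop) {w : ℝ} (hw : 0 ≤ w) (S : Finset V) (d : ℕ) :
    ((S.powerset.filter fun N : Finset V =>
      (N : Set V).Pairwise (fun x y => ¬ Γ x y) ∧ N.card = d).card : ℝ) * w ^ d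
      ≤ indepSum Γ w S := by
  unfold indepSum
  rw [← nsmul_eq_mul, ← Finset.sum_const, Finset.sum_filter]
  refine Finset.sum_le_sum fun N _ => ?_
  split_ifs with h1 h2 h2
  · rw [h1.2]
  · exact absurd h1.1 h2
  · positivity
  · exact le_rfl

end KleitmanWinston

/-! ### Cherries and two-paths in graphs without four-cycles. -/

section FourCycleFree

open scoped Classical

variable {V : Type*}

/-- Any two distinct vertices have at most one common neighbour. -/
def SimpleGraph.FourCycleFree (G : SimpleGraph V) : Prop :=
  ∀ ⦃x y⦄, x ≠ y → ∀ ⦃u v⦄, G.Adj x u → G.Adj y u → G.Adj x v → G.Adj y v → u = v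

/-- The pairs of distinct vertices joined by a path of length two. -/
def SimpleGraph.TwoPath (G : SimpleGraph V) (x y : V) : Prop :=
  x ≠ y ∧ ∃ u, G.Adj x u ∧ G.Adj y u

/-- The indicator function of adjacency. -/
noncomputable def SimpleGraph.ind (G : SimpleGraph V) (x y : V) : ℝ := if G.Adj x y then 1 else 0

theorem SimpleGraph.ind_nonneg (G : SimpleGraph V) (x y : V) : 0 ≤ G.ind x y := by
  unfold ind; split_ifs <;> norm_num

theorem SimpleGraph.ind_mul_self (G : SimpleGraph V) (x y : V) :
    G.ind x y * G.ind x y = G.ind x y := by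
  unfold ind; split_ifs <;> norm_num

theorem SimpleGraph.ind_comm (G : SimpleGraph V) (x y : V) : G.ind x y = G.ind y x := by
  unfold ind; simp [G.adj_comm]

theorem SimpleGraph.ind_self (G : SimpleGraph V) (x : V) : G.ind x x = 0 := by
  simp [ind]

variable [Fintype V]

theorem SimpleGraph.sum_ind (G : SimpleGraph V) (x : V) : ∑ u, G.ind x u = G.degree x := by
  simp [ind, ← SimpleGraph.card_neighborFinset_eq_degree, SimpleGraph.neighborFinset_eq_filter]

theorem SimpleGraph.FourCycleFree.sum_ind_mul_ind_le {G : SimpleGraph V} (hG : G.FourCycleFree)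
    {x y : V} (hxy : x ≠ y) : ∑ u, G.ind x u * G.ind y u ≤ if G.TwoPath x y then 1 else 0 := by
  have key : ∑ u, G.ind x u * G.ind y u
      = ((Finset.univ.filter fun u => G.Adj x u ∧ G.Adj y u).card : ℝ) := by
    rw [Finset.card_filter]
    push_cast
    refine Finset.sum_congr rfl fun u _ => ?_
    unfold ind
    split_ifs <;> simp_all
  rw [key]
  split_ifs with h
  · have : (Finset.univ.filter fun u => G.Adj x u ∧ G.Adj y u).card ≤ 1 := by
      refine Finset.card_le_one.2 fun u hu v hv => ?_
      simp only [Finset.mem_filter, Finset.mem_univ, true_and] at hu hv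
      exact hG hxy hu.1 hu.2 hv.1 hv.2
    exact_mod_cast this
  · rw [Finset.filter_false_of_mem]
    · simp
    · exact fun u _ hu => h ⟨hxy, u, hu⟩

theorem SimpleGraph.FourCycleFree.sum_ind_mul_ind_le_one {G : SimpleGraph V}
    (hG : G.FourCycleFree) {x y : V} (hxy : x ≠ y) : ∑ u, G.ind x u * G.ind y u ≤ 1 := by
  refine (hG.sum_ind_mul_ind_le hxy).trans ?_
  split_ifs <;> norm_num

/-- Cherries with both ends in `S`, counted by their middle vertex. -/
theorem SimpleGraph.FourCycleFree.sq_sum_degree_le {G : SimpleGraph V} (hG : G.FourCycleFree)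
    (S : Finset V) :
    (∑ x ∈ S, (G.degree x : ℝ)) ^ 2 ≤ Fintype.card V *
      (∑ x ∈ S, (G.degree x : ℝ)
        + ∑ x ∈ S, (((S.erase x).filter fun y => G.TwoPath x y).card : ℝ)) := by
  have h1 : ∑ x ∈ S, (G.degree x : ℝ) = ∑ u, ∑ x ∈ S, G.ind x u := by
    rw [Finset.sum_comm]
    exact Finset.sum_congr rfl fun x _ => (G.sum_ind x).symm
  have h2 : (∑ x ∈ S, (G.degree x : ℝ)) ^ 2
      ≤ Fintype.card V * ∑ u, (∑ x ∈ S, G.ind x u) ^ 2 := by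
    rw [h1]
    simpa using sq_sum_le_card_mul_sum_sq (s := Finset.univ) (f := fun u => ∑ x ∈ S, G.ind x u)
  refine h2.trans ?_
  gcongr
  calc ∑ u, (∑ x ∈ S, G.ind x u) ^ 2
      = ∑ x ∈ S, ∑ y ∈ S, ∑ u, G.ind x u * G.ind y u := by
        simp_rw [sq, Finset.sum_mul_sum]
        rw [Finset.sum_comm]
        exact Finset.sum_congr rfl fun x _ => Finset.sum_comm
    _ = ∑ x ∈ S, (∑ u, G.ind x u * G.ind x u
          + ∑ y ∈ S.erase x, ∑ u, G.ind x u * G.ind y u) :=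
        Finset.sum_congr rfl fun x hx => (Finset.add_sum_erase S _ hx).symm
    _ ≤ ∑ x ∈ S, ((G.degree x : ℝ)
          + ∑ y ∈ S.erase x, if G.TwoPath x y then (1 : ℝ) else 0) := by
        refine Finset.sum_le_sum fun x _ => add_le_add ?_ (Finset.sum_le_sum fun y hy => ?_)
        · simp_rw [G.ind_mul_self, G.sum_ind, le_refl]
        · exact hG.sum_ind_mul_ind_le (Finset.ne_of_mem_erase hy).symm
    _ = _ := by
        rw [Finset.sum_add_distrib]
        simp

/-- Cauchy–Schwarz over the middle vertices yields many cherries with both ends in S. Distinct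
cherries join distinct pairs, so some vertex has at least the average number of two-path partners.
-/
theorem SimpleGraph.FourCycleFree.exists_twoPath_dense {G : SimpleGraph V}
    (hG : G.FourCycleFree) {δ : ℝ} (hδ : 0 < δ) (S : Finset V)
    (hS : ∀ x ∈ S, δ ≤ G.degree x) (hR : 2 * Fintype.card V / δ < S.card) :
    ∃ v ∈ S, δ ^ 2 / (2 * Fintype.card V) * S.card
      ≤ ((S.erase v).filter fun y => G.TwoPath v y).card := by
  have hSpos : (0 : ℝ) < S.card := lt_of_le_of_lt (by positivity) hR
  have hSne : S.Nonempty := by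
    rw [← Finset.card_pos]; exact_mod_cast hSpos
  have hn : (0 : ℝ) < Fintype.card V := by
    obtain ⟨v, _⟩ := hSne
    exact_mod_cast Fintype.card_pos_iff.2 ⟨v⟩
  apply Finset.exists_le_of_sum_le hSne
  have h := hG.sq_sum_degree_le S
  have hX : S.card * δ ≤ ∑ x ∈ S, (G.degree x : ℝ) := by
    rw [← nsmul_eq_mul]; exact Finset.card_nsmul_le_sum _ _ _ hS
  set X := ∑ x ∈ S, (G.degree x : ℝ)
  rw [div_lt_iff₀ hδ] at hR
  rw [Finset.sum_const, nsmul_eq_mul]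
  set T := ∑ x ∈ S, (((S.erase x).filter fun y => G.TwoPath x y).card : ℝ)
  set n := (Fintype.card V : ℝ)
  -- Since X ≥ |S| δ > 2n, the degenerate term nX is at most X²/2 and is absorbed.
  have h3 : X ^ 2 ≤ 2 * (n * T) := by nlinarith
  have h4 : (S.card * δ) ^ 2 ≤ X ^ 2 := by gcongr
  calc (S.card : ℝ) * (δ ^ 2 / (2 * n) * S.card) = (S.card * δ) ^ 2 / (2 * n) := by
        field_simp
    _ ≤ (2 * (n * T)) / (2 * n) := by gcongr; linarith
    _ = T := by field_simp

end FourCycleFree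

/-! ### Candidate neighbourhoods of a given size. -/

section CountIndependent

open scoped Classical

/-- The left side is the cost, in the exponent, of recording q selected vertices when q ≤ 8 log³ n /
c² + 1. -/
theorem eventually_log_le_sqrt {c : ℝ} (hc : 0 < c) :
    ∀ᶠ n : ℕ in atTop, 16 * Real.log n ^ 4 / c ^ 2 + 2 * Real.log n ≤ c * Real.sqrt n := by
  have h1 : ∀ k : ℕ, (fun x : ℝ => Real.log x ^ k) =o[atTop] fun x : ℝ => Real.sqrt x := by
    intro k
    have := isLittleO_log_rpow_rpow_atTop (k : ℝ) (show (0 : ℝ) < 1 / 2 by norm_num)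
    simpa [Real.sqrt_eq_rpow] using this
  have h2 : (fun x : ℝ => 16 * Real.log x ^ 4 / c ^ 2 + 2 * Real.log x) =o[atTop]
      fun x : ℝ => Real.sqrt x := by
    refine IsLittleO.add ?_ ?_
    · refine ((h1 4).const_mul_left (16 / c ^ 2)).congr_left fun x => by ring
    · simpa using (h1 1).const_mul_left 2
  have h3 := tendsto_natCast_atTop_atTop.eventually (h2.bound hc)
  filter_upwards [h3] with n hn
  refine (le_abs_self _).trans ?_
  rw [Real.norm_eq_abs, Real.norm_eq_abs, abs_of_nonneg (Real.sqrt_nonneg _)] at hn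
  exact hn

/-- For small d the trivial count n^d of all d-sets suffices. -/
theorem card_indep_le_of_mul_log_le {V : Type*} [Fintype V]
    (Γ : V → V → Prop) (U : Finset V) {d : ℕ} {t : ℝ} (hV : 0 < Fintype.card V)
    (hd : d * Real.log (Fintype.card V) ≤ t) :
    ((U.powerset.filter fun N : Finset V =>
      (N : Set V).Pairwise (fun x y => ¬ Γ x y) ∧ N.card = d).card : ℝ) ≤ Real.exp t := by
  have hn : (0 : ℝ) < Fintype.card V := by exact_mod_cast hV
  have h1 : (U.powerset.filter fun N : Finset V =>
      (N : Set V).Pairwise (fun x y => ¬ Γ x y) ∧ N.card = d).card ≤ Fintype.card V ^ d := by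
    calc _ ≤ (Finset.powersetCard d U).card := by
          refine Finset.card_le_card fun N hN => ?_
          simp only [Finset.mem_filter, Finset.mem_powerset] at hN
          exact Finset.mem_powersetCard.2 ⟨hN.1, hN.2.2⟩
      _ ≤ U.card ^ d := by
          rw [Finset.card_powersetCard]; exact Nat.choose_le_pow _ _
      _ ≤ _ := by gcongr; exact Finset.card_le_univ U
  calc _ ≤ ((Fintype.card V : ℝ)) ^ d := by exact_mod_cast h1
    _ = Real.exp (d * Real.log (Fintype.card V)) := by
      rw [Real.exp_nat_mul, Real.exp_log hn]
    _ ≤ _ := Real.exp_le_exp.2 hd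

/-- Once d exceeds c√n / log n, the two-path relation is dense enough that only polylogarithmically
many selections are needed. Three factors exp(c√n) arise: from the selections, from the residual set
of size R, and from removing the weight w^d. -/
theorem SimpleGraph.FourCycleFree.card_indep_le_of_dense {V : Type*} [Fintype V]
    {G : SimpleGraph V} (hG : G.FourCycleFree) (U : Finset V) {d : ℕ} {c : ℝ} (hc : 0 < c)
    (hdU : ∀ x ∈ U, d ≤ G.degree x + 1)
    (hn2 : 2 ≤ Fintype.card V)
    (hlog : 16 * Real.log (Fintype.card V) ^ 4 / c ^ 2 + 2 * Real.log (Fintype.card V)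
      ≤ c * Real.sqrt (Fintype.card V))
    (hdn : d ≤ Fintype.card V)
    (hd : c * Real.sqrt (Fintype.card V) < d * Real.log (Fintype.card V)) :
    ((U.powerset.filter fun N : Finset V =>
      (N : Set V).Pairwise (fun x y => ¬ G.TwoPath x y) ∧ N.card = d).card : ℝ)
      ≤ max 1 (4 / c ^ 2) ^ d * Real.exp (3 * c * Real.sqrt (Fintype.card V)) := by
  set L := max 1 (4 / c ^ 2) with hL
  have hUn : U.card ≤ Fintype.card V := Finset.card_le_univ U
  have hdegN : ∀ x ∈ U, (d : ℝ) ≤ G.degree x + 1 := fun x hx => by exact_mod_cast hdU x hx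
  have hdense := fun (δ : ℝ) (hδ : 0 < δ) (S : Finset V) => hG.exists_twoPath_dense hδ S
  set n := Fintype.card V
  have hnR : (2 : ℝ) ≤ n := by exact_mod_cast hn2
  have hn0 : (0 : ℝ) < n := by linarith
  have hs0 : 0 < Real.sqrt n := Real.sqrt_pos.2 hn0
  have hss : Real.sqrt n * Real.sqrt n = n := Real.mul_self_sqrt hn0.le
  set s := Real.sqrt n
  have hl0 : 0 < Real.log n := Real.log_pos (by linarith)
  have hd2 : (2 : ℝ) < d := by
    have : 0 ≤ 16 * Real.log n ^ 4 / c ^ 2 := by positivity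
    nlinarith
  have hdR : (0 : ℝ) < d := by linarith
  -- Degrees in U are at least d - 1, which is at least d / 2 because d > 2.
  set δ : ℝ := d / 2 with hδ
  have hδ0 : 0 < δ := by positivity
  set R : ℝ := 2 * n / δ with hRdef
  have hR4 : R = 4 * n / d := by rw [hRdef, hδ]; field_simp; ring
  have hR1 : 1 ≤ R := by
    rw [hR4, le_div_iff₀ hdR]
    have : (d : ℝ) ≤ n := by exact_mod_cast hdn
    linarith
  set β : ℝ := δ ^ 2 / (2 * n) with hβ
  have hβ0 : 0 < β := by positivity
  -- As R = 4n/d, this is the weight that makes wR ≤ c√n; the truncation at 1 is required by the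
  -- recursion.
  set w : ℝ := min 1 (c * d / (4 * s)) with hw
  have hw0 : 0 < w := lt_min one_pos (by positivity)
  -- With R ≥ 1 this gives n ≤ R exp(βq), so q selections suffice starting from any subset of the
  -- vertices.
  set q : ℕ := ⌈Real.log n / β⌉₊ with hq
  have hq1 : Real.log n ≤ β * q := by
    have := Nat.le_ceil (Real.log n / β)
    rw [div_le_iff₀ hβ0] at this
    linarith
  have hq2 : (q : ℝ) ≤ 8 * Real.log n ^ 3 / c ^ 2 + 1 := by
    have h1 := (Nat.ceil_lt_add_one (show 0 ≤ Real.log n / β by positivity)).le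
    refine h1.trans (add_le_add ?_ le_rfl)
    rw [div_le_div_iff₀ hβ0 (by positivity), hβ, hδ]
    have h2 : c ^ 2 * n ≤ d ^ 2 * Real.log n ^ 2 := by
      have h3 : (c * s) ^ 2 ≤ (d * Real.log n) ^ 2 := by gcongr
      calc c ^ 2 * n = (c * s) ^ 2 := by rw [← hss]; ring
        _ ≤ _ := h3
        _ = _ := by ring
    have h4 : 8 * Real.log n ^ 3 * ((d / 2 : ℝ) ^ 2 / (2 * n))
        = Real.log n * (d ^ 2 * Real.log n ^ 2) / n := by field_simp; ring
    rw [h4, le_div_iff₀ hn0]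
    calc Real.log n * c ^ 2 * n = Real.log n * (c ^ 2 * n) := by ring
      _ ≤ _ := by gcongr
  have hmain := indepSum_le_of_locally_dense G.TwoPath U hw0.le (min_le_left _ _)
    (β := β) (R := R) (fun S hSU hRS => hdense δ hδ0 S (fun x hx => by
      have := hdegN x (hSU hx); rw [hδ]; linarith) hRS) U subset_rfl q (by
      calc (U.card : ℝ) ≤ n := by exact_mod_cast hUn
        _ = 1 * Real.exp (Real.log n) := by rw [Real.exp_log hn0, one_mul]
        _ ≤ _ := by gcongr)
  have hcount := (card_indep_mul_pow_le G.TwoPath hw0.le U d).trans hmain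
  have hwR : w * R ≤ c * s := by
    calc w * R ≤ c * d / (4 * s) * R := by gcongr; exact min_le_right _ _
      _ = c * s := by rw [hR4, ← hss]; field_simp
  have hpow : (1 + U.card : ℝ) ^ q ≤ Real.exp (c * s) := by
    have h1 : (1 + U.card : ℝ) ≤ (n : ℝ) ^ 2 := by
      have : (U.card : ℝ) ≤ n := by exact_mod_cast hUn
      nlinarith
    calc (1 + U.card : ℝ) ^ q ≤ ((n : ℝ) ^ 2) ^ q := by gcongr
      _ = Real.exp (q * (2 * Real.log n)) := by
        rw [Real.exp_nat_mul, two_mul, Real.exp_add, Real.exp_log hn0, sq]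
      _ ≤ _ := by
        rw [Real.exp_le_exp]
        calc (q : ℝ) * (2 * Real.log n) ≤ (8 * Real.log n ^ 3 / c ^ 2 + 1) * (2 * Real.log n) := by
              gcongr
          _ = 16 * Real.log n ^ 4 / c ^ 2 + 2 * Real.log n := by ring
          _ ≤ _ := hlog
  have hL1 : 1 ≤ L := le_max_left _ _
  -- The inverse weight 4s/(cd) equals (4/c²)(cs/d), and x ≤ exp x. Its d-th power is thus at most
  -- L^d exp(cs), with L independent of d and n.
  have hwL : 1 ≤ w * (L * Real.exp (c * s / d)) := by
    have he : c * s / d ≤ Real.exp (c * s / d) := by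
      linarith [Real.add_one_le_exp (c * s / d)]
    have he1 : 1 ≤ Real.exp (c * s / d) := Real.one_le_exp (by positivity)
    rcases min_choice 1 (c * d / (4 * s)) with h | h
    · rw [hw, h, one_mul]; exact one_le_mul_of_one_le_of_one_le hL1 he1
    · rw [hw, h]
      calc (1 : ℝ) = c * d / (4 * s) * (4 / c ^ 2 * (c * s / d)) := by field_simp
        _ ≤ _ := by gcongr; exact le_max_right _ _
  have hwd : 1 ≤ w ^ d * (L ^ d * Real.exp (c * s)) := by
    have h1 := one_le_pow₀ (n := d) hwL
    have h2 : Real.exp (c * s) = Real.exp (c * s / d) ^ d := by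
      rw [← Real.exp_nat_mul]; congr 1; field_simp
    rwa [h2, ← mul_pow, ← mul_pow]
  set C : ℝ := ((U.powerset.filter fun N : Finset V =>
      (N : Set V).Pairwise (fun x y => ¬ G.TwoPath x y) ∧ N.card = d).card : ℝ)
  have hC0 : 0 ≤ C := Nat.cast_nonneg _
  calc C ≤ C * (w ^ d * (L ^ d * Real.exp (c * s))) := le_mul_of_one_le_right hC0 hwd
    _ = C * w ^ d * (L ^ d * Real.exp (c * s)) := by ring
    _ ≤ (1 + U.card : ℝ) ^ q * Real.exp (w * R) * (L ^ d * Real.exp (c * s)) := by gcongr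
    _ ≤ Real.exp (c * s) * Real.exp (c * s) * (L ^ d * Real.exp (c * s)) := by gcongr
    _ = L ^ d * (Real.exp (c * s) * Real.exp (c * s) * Real.exp (c * s)) := by ring
    _ = _ := by
      rw [← Real.exp_add, ← Real.exp_add]; congr 2; ring

/-- The number of candidate neighbourhoods of size `d` for a new vertex of minimum degree. -/
theorem SimpleGraph.FourCycleFree.exists_card_indep_le {c : ℝ} (hc : 0 < c) :
    ∃ L : ℝ, 1 ≤ L ∧ ∃ n₀ : ℕ, ∀ (V : Type) [Fintype V], n₀ ≤ Fintype.card V →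
      ∀ G : SimpleGraph V, G.FourCycleFree → ∀ (U : Finset V) (d : ℕ),
        (∀ x ∈ U, d ≤ G.degree x + 1) →
        ((U.powerset.filter fun N : Finset V =>
          (N : Set V).Pairwise (fun x y => ¬ G.TwoPath x y) ∧ N.card = d).card : ℝ)
          ≤ L ^ d * Real.exp (c * Real.sqrt (Fintype.card V)) := by
  obtain ⟨n₀, hn₀⟩ := eventually_atTop.1 (eventually_log_le_sqrt (show 0 < c / 3 by positivity))
  refine ⟨max 1 (4 / (c / 3) ^ 2), le_max_left _ _, max n₀ 2, fun V _ hV G hG U d hd => ?_⟩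
  have hV2 : 2 ≤ Fintype.card V := (le_max_right _ _).trans hV
  by_cases hdn : d ≤ Fintype.card V
  · rcases le_or_gt (d * Real.log (Fintype.card V)) (c / 3 * Real.sqrt (Fintype.card V)) with h | h
    · have h1 := card_indep_le_of_mul_log_le G.TwoPath U (by omega) h
      refine h1.trans ?_
      have h2 : (1 : ℝ) ≤ max 1 (4 / (c / 3) ^ 2) ^ d := one_le_pow₀ (le_max_left _ _)
      calc Real.exp (c / 3 * Real.sqrt (Fintype.card V))
          ≤ 1 * Real.exp (c * Real.sqrt (Fintype.card V)) := by
            rw [one_mul]; gcongr; linarith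
        _ ≤ _ := by gcongr
    · have := hG.card_indep_le_of_dense U (by positivity) hd hV2
        (hn₀ _ ((le_max_left _ _).trans hV)) hdn h
      rwa [show 3 * (c / 3) = c by ring] at this
  · rw [Finset.filter_false_of_mem]
    · simp; positivity
    · rintro N - ⟨-, hN⟩
      exact hdn (hN ▸ Finset.card_le_univ N)

end CountIndependent

/-! ### Counting C4-free graphs by peeling vertices of minimum degree. -/

section CountFourCycleFree

open scoped Classical

variable {V : Type*} [Fintype V]

/-- The graphs without four-cycle all of whose edges lie inside `S`. -/
noncomputable def fourCycleFreeOn (S : Finset V) : Finset (SimpleGraph V) :=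
  Finset.univ.filter fun G => G.FourCycleFree ∧ ∀ x y, G.Adj x y → x ∈ S

/-- The graphs without four-cycle that have at most `m` edges. -/
noncomputable def sparseFourCycleFree (V : Type*) [Fintype V] (m : ℕ) : Finset (SimpleGraph V) :=
  Finset.univ.filter fun G => G.FourCycleFree ∧ G.edgeFinset.card ≤ m

theorem mem_sparseFourCycleFree {m : ℕ} {G : SimpleGraph V} :
    G ∈ sparseFourCycleFree V m ↔ G.FourCycleFree ∧ G.edgeFinset.card ≤ m := by
  simp [sparseFourCycleFree]

/-- The sets that can be the neighbourhood of a new vertex of minimum degree. -/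
noncomputable def newNeighborhoods (G : SimpleGraph V) (S : Finset V) : Finset (Finset V) :=
  S.powerset.filter fun N : Finset V =>
    (N : Set V).Pairwise (fun x y => ¬ G.TwoPath x y) ∧ ∀ x ∈ S, N.card ≤ G.degree x + 1

/-- The weight cancels the factor L^d, leaving Q for each of the n + 1 possible sizes. -/
theorem sum_newNeighborhoods_le {L Q : ℝ} (hL : 1 ≤ L)
    (hcount : ∀ G : SimpleGraph V, G.FourCycleFree → ∀ (U : Finset V) (d : ℕ),
      (∀ x ∈ U, d ≤ G.degree x + 1) →
      ((U.powerset.filter fun N : Finset V =>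
        (N : Set V).Pairwise (fun x y => ¬ G.TwoPath x y) ∧ N.card = d).card : ℝ) ≤ L ^ d * Q)
    {G : SimpleGraph V} (hG : G.FourCycleFree) (S : Finset V) (hQ : 0 ≤ Q) :
    ∑ N ∈ newNeighborhoods G S, L⁻¹ ^ N.card ≤ (Fintype.card V + 1) * Q := by
  have hL0 : 0 < L := by linarith
  rw [← Finset.sum_fiberwise_of_maps_to (t := Finset.range (Fintype.card V + 1))
    (g := fun N : Finset V => N.card)
    (fun N _ => Finset.mem_range.2 (Nat.lt_succ_of_le (Finset.card_le_univ N)))]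
  have key : ∀ d ∈ Finset.range (Fintype.card V + 1),
      ∑ N ∈ (newNeighborhoods G S).filter (fun N => N.card = d), L⁻¹ ^ N.card ≤ Q := by
    intro d _
    by_cases hd : ∀ x ∈ S, d ≤ G.degree x + 1
    · have h1 := hcount G hG S d hd
      calc ∑ N ∈ (newNeighborhoods G S).filter (fun N => N.card = d), L⁻¹ ^ N.card
          ≤ ∑ N ∈ S.powerset.filter (fun N : Finset V =>
              (N : Set V).Pairwise (fun x y => ¬ G.TwoPath x y) ∧ N.card = d), L⁻¹ ^ N.card := by
            refine Finset.sum_le_sum_of_subset_of_nonneg (fun N hN => ?_)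
              fun _ _ _ => by positivity
            simp only [newNeighborhoods, Finset.mem_filter] at hN ⊢
            exact ⟨hN.1.1, hN.1.2.1, hN.2⟩
        _ = ∑ N ∈ S.powerset.filter (fun N : Finset V =>
              (N : Set V).Pairwise (fun x y => ¬ G.TwoPath x y) ∧ N.card = d), L⁻¹ ^ d :=
            Finset.sum_congr rfl fun N hN => by rw [(Finset.mem_filter.1 hN).2.2]
        _ ≤ (L ^ d * Q) * L⁻¹ ^ d := by
            rw [Finset.sum_const, nsmul_eq_mul]
            gcongr
        _ = Q := by rw [inv_pow]; field_simp
    · rw [Finset.filter_false_of_mem]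
      · simpa using hQ
      · intro N hN h
        simp only [newNeighborhoods, Finset.mem_filter] at hN
        exact hd (h ▸ hN.2.2)
  refine (Finset.sum_le_sum key).trans ?_
  simp

/-- Delete a vertex v of minimum degree in S. The graph is recovered from v, the remaining graph and
N(v). Two vertices of N(v) joined by a two-path avoiding v would close a four-cycle, and minimality
gives |N(v)| ≤ deg x + 1 in the remaining graph for every other x in S. The edge weight splits as a
product, so each peeled vertex costs a factor n(n + 1)Q. -/
theorem sum_fourCycleFreeOn_le {L Q : ℝ} (hL : 1 ≤ L) (hQ : 0 ≤ Q)
    (hcount : ∀ G : SimpleGraph V, G.FourCycleFree → ∀ (U : Finset V) (d : ℕ),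
      (∀ x ∈ U, d ≤ G.degree x + 1) →
      ((U.powerset.filter fun N : Finset V =>
        (N : Set V).Pairwise (fun x y => ¬ G.TwoPath x y) ∧ N.card = d).card : ℝ) ≤ L ^ d * Q)
    (S : Finset V) :
    ∑ G ∈ fourCycleFreeOn S, L⁻¹ ^ G.edgeFinset.card
      ≤ (Fintype.card V * ((Fintype.card V + 1) * Q)) ^ S.card := by
  have hL0 : 0 < L := by linarith
  set n : ℝ := (Fintype.card V : ℝ) with hn
  have hn0 : 0 ≤ n := Nat.cast_nonneg _
  induction hm : S.card generalizing S with
  | zero =>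
    rw [Finset.card_eq_zero] at hm
    subst hm
    have : fourCycleFreeOn (∅ : Finset V) ⊆ {⊥} := by
      intro G hG
      simp only [fourCycleFreeOn, Finset.mem_filter] at hG
      rw [Finset.mem_singleton, eq_bot_iff]
      intro x y hxy
      exact absurd (hG.2.2 x y hxy) (Finset.notMem_empty x)
    refine (Finset.sum_le_sum_of_subset_of_nonneg this fun _ _ _ => by positivity).trans ?_
    rw [Finset.sum_singleton, pow_zero]
    exact pow_le_one₀ (by positivity) (inv_le_one_of_one_le₀ hL)
  | succ m ih =>
    have hne : S.Nonempty := Finset.card_pos.1 (by omega)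
    choose v hvS hvmin using fun G : SimpleGraph V =>
      Finset.exists_min_image S (fun x => G.degree x) hne
    let T : Finset ((_ : V) × (_ : SimpleGraph V) × Finset V) :=
      S.sigma fun x => (fourCycleFreeOn (S.erase x)).sigma fun G => newNeighborhoods G (S.erase x)
    let φ : SimpleGraph V → (_ : V) × (_ : SimpleGraph V) × Finset V := fun G =>
      ⟨v G, G.deleteIncidenceSet (v G), G.neighborFinset (v G)⟩
    have hdel : ∀ G : SimpleGraph V, ∀ x, G.degree x ≤ (G.deleteIncidenceSet (v G)).degree x + 1
        ∨ x = v G := by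
      intro G x
      by_cases hx : x = v G
      · exact Or.inr hx
      left
      rw [← SimpleGraph.card_neighborFinset_eq_degree, ← SimpleGraph.card_neighborFinset_eq_degree]
      refine (Finset.card_le_card (t := insert (v G)
        ((G.deleteIncidenceSet (v G)).neighborFinset x)) fun y hy => ?_).trans
        (Finset.card_insert_le _ _)
      rw [SimpleGraph.mem_neighborFinset] at hy
      rw [Finset.mem_insert, SimpleGraph.mem_neighborFinset, SimpleGraph.deleteIncidenceSet_adj]
      tauto
    have hmaps : ∀ G ∈ fourCycleFreeOn S, φ G ∈ T := by
      intro G hG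
      simp only [fourCycleFreeOn, Finset.mem_filter, Finset.mem_univ, true_and] at hG
      obtain ⟨hG1, hG2⟩ := hG
      simp only [T, φ, Finset.mem_sigma]
      refine ⟨hvS G, ?_, ?_⟩
      · simp only [fourCycleFreeOn, Finset.mem_filter, Finset.mem_univ, true_and]
        refine ⟨fun x y hxy u w h1 h2 h3 h4 => ?_, fun x y hxy => ?_⟩
        · rw [SimpleGraph.deleteIncidenceSet_adj] at h1 h2 h3 h4
          exact hG1 hxy h1.1 h2.1 h3.1 h4.1
        · rw [SimpleGraph.deleteIncidenceSet_adj] at hxy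
          exact Finset.mem_erase.2 ⟨hxy.2.1, hG2 x y hxy.1⟩
      · simp only [newNeighborhoods, Finset.mem_filter, Finset.mem_powerset]
        refine ⟨fun x hx => ?_, fun x hx y hy hxy => ?_, fun x hx => ?_⟩
        · rw [SimpleGraph.mem_neighborFinset] at hx
          exact Finset.mem_erase.2 ⟨hx.ne', hG2 x _ hx.symm⟩
        · rintro ⟨-, u, hu1, hu2⟩
          rw [SimpleGraph.deleteIncidenceSet_adj] at hu1 hu2
          simp only [Finset.mem_coe, SimpleGraph.mem_neighborFinset] at hx hy
          exact hu1.2.2 (hG1 hxy hu1.1 hu2.1 hx.symm hy.symm)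
        · obtain ⟨hx1, hx2⟩ := Finset.mem_erase.1 hx
          rw [SimpleGraph.card_neighborFinset_eq_degree]
          refine (hvmin G x hx2).trans (((hdel G x).resolve_right hx1).trans (le_of_eq ?_))
          congr!
    have hinj : Set.InjOn φ (fourCycleFreeOn S) := by
      intro G _ H _ h
      simp only [φ, Sigma.mk.injEq, heq_eq_eq] at h
      obtain ⟨h1, h2, h3⟩ := h
      ext x y
      have h4 : ∀ z, G.Adj (v G) z ↔ H.Adj (v G) z := fun z => by
        rw [← SimpleGraph.mem_neighborFinset, h3, SimpleGraph.mem_neighborFinset, h1]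
      by_cases hx : x = v G
      · rw [hx, h4]
      by_cases hy : y = v G
      · rw [hy, G.adj_comm, H.adj_comm, h4]
      have h5 : (G.deleteIncidenceSet (v G)).Adj x y ↔ (H.deleteIncidenceSet (v H)).Adj x y := by
        rw [h2]
      rw [SimpleGraph.deleteIncidenceSet_adj, SimpleGraph.deleteIncidenceSet_adj, ← h1] at h5
      tauto
    have hval : ∀ G : SimpleGraph V, L⁻¹ ^ G.edgeFinset.card
        = L⁻¹ ^ (φ G).2.1.edgeFinset.card * L⁻¹ ^ (φ G).2.2.card := by
      intro G
      have h1 := G.card_edgeFinset_deleteIncidenceSet (v G)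
      have h2 := G.degree_le_card_edgeFinset (v G)
      rw [← pow_add]
      congr 1
      simp only [φ, SimpleGraph.card_neighborFinset_eq_degree]
      convert (Nat.sub_add_cancel h2).symm using 2
    calc ∑ G ∈ fourCycleFreeOn S, L⁻¹ ^ G.edgeFinset.card
        = ∑ G ∈ fourCycleFreeOn S,
            L⁻¹ ^ (φ G).2.1.edgeFinset.card * L⁻¹ ^ (φ G).2.2.card :=
          Finset.sum_congr rfl fun G _ => hval G
      _ = ∑ p ∈ (fourCycleFreeOn S).image φ,
            L⁻¹ ^ p.2.1.edgeFinset.card * L⁻¹ ^ p.2.2.card := by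
          rw [Finset.sum_image hinj]
          refine Finset.sum_congr rfl fun G _ => ?_
          congr!
      _ ≤ ∑ p ∈ T, L⁻¹ ^ p.2.1.edgeFinset.card * L⁻¹ ^ p.2.2.card :=
          Finset.sum_le_sum_of_subset_of_nonneg (Finset.image_subset_iff.2 hmaps)
            fun _ _ _ => by positivity
      _ = ∑ x ∈ S, ∑ G ∈ fourCycleFreeOn (S.erase x), ∑ N ∈ newNeighborhoods G (S.erase x),
            L⁻¹ ^ G.edgeFinset.card * L⁻¹ ^ N.card := by
          simp only [T, Finset.sum_sigma]
      _ ≤ ∑ x ∈ S, ∑ G ∈ fourCycleFreeOn (S.erase x),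
            L⁻¹ ^ G.edgeFinset.card * ((n + 1) * Q) := by
          refine Finset.sum_le_sum fun x _ => Finset.sum_le_sum fun G hG => ?_
          rw [← Finset.mul_sum]
          gcongr
          refine sum_newNeighborhoods_le hL hcount ?_ _ hQ
          simp only [fourCycleFreeOn, Finset.mem_filter] at hG
          exact hG.2.1
      _ ≤ ∑ x ∈ S, (n * ((n + 1) * Q)) ^ m * ((n + 1) * Q) := by
          refine Finset.sum_le_sum fun x hx => ?_
          rw [← Finset.sum_mul]
          gcongr
          refine ih _ ?_
          rw [Finset.card_erase_of_mem hx, hm]; rfl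
      _ = S.card * ((n * ((n + 1) * Q)) ^ m * ((n + 1) * Q)) := by
          rw [Finset.sum_const, nsmul_eq_mul]
      _ ≤ n * ((n * ((n + 1) * Q)) ^ m * ((n + 1) * Q)) := by
          gcongr
          rw [hn]
          exact_mod_cast Finset.card_le_univ S
      _ = _ := by ring

/-- For every `c > 0` there is a rate `a` such that there are at most `exp (c n ^ (3 / 2) + a m)`
graphs without four-cycle on `n` vertices with at most `m` edges. -/
theorem exists_card_fourCycleFree_le {c : ℝ} (hc : 0 < c) :
    ∃ a : ℝ, 0 ≤ a ∧ ∃ n₀ : ℕ, ∀ (V : Type) [Fintype V], n₀ ≤ Fintype.card V → ∀ m : ℕ,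
      ((sparseFourCycleFree V m).card : ℝ)
        ≤ Real.exp (c * (Fintype.card V : ℝ) ^ (3 / 2 : ℝ) + a * m) := by
  obtain ⟨L, hL, n₁, hn₁⟩ :=
    SimpleGraph.FourCycleFree.exists_card_indep_le (show 0 < c / 2 by positivity)
  have hL0 : 0 < L := by linarith
  obtain ⟨n₂, hn₂⟩ := eventually_atTop.1 (eventually_log_le_sqrt (show 0 < c / 4 by positivity))
  -- A graph with at most m edges has weight at least L^{-m}, so dividing by the weight costs L^m =
  -- exp(m log L).
  refine ⟨Real.log L, Real.log_nonneg hL, max (max n₁ n₂) 2, fun V _ hV m => ?_⟩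
  have h1 : n₁ ≤ Fintype.card V := le_trans (by simp) hV
  have h2 : n₂ ≤ Fintype.card V := le_trans (by simp) hV
  have h3 : 2 ≤ Fintype.card V := le_trans (by simp) hV
  have hlog := hn₂ _ h2
  have hcnt := sum_fourCycleFreeOn_le hL (Real.exp_pos _).le (hn₁ V h1) Finset.univ
  rw [Finset.card_univ] at hcnt
  set n := Fintype.card V
  have hnR : (2 : ℝ) ≤ n := by exact_mod_cast h3
  have hn0 : (0 : ℝ) < n := by linarith
  set C := sparseFourCycleFree V m
  have hlow : (C.card : ℝ) * L⁻¹ ^ m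
      ≤ ∑ G ∈ fourCycleFreeOn (Finset.univ : Finset V), L⁻¹ ^ G.edgeFinset.card := by
    calc (C.card : ℝ) * L⁻¹ ^ m = ∑ G ∈ C, L⁻¹ ^ m := by
          rw [Finset.sum_const, nsmul_eq_mul]
      _ ≤ ∑ G ∈ C, L⁻¹ ^ G.edgeFinset.card := by
          refine Finset.sum_le_sum fun G hG => ?_
          exact pow_le_pow_of_le_one (by positivity) (inv_le_one_of_one_le₀ hL)
            (mem_sparseFourCycleFree.1 hG).2
      _ ≤ _ := by
          refine Finset.sum_le_sum_of_subset_of_nonneg (fun G hG => ?_)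
            fun _ _ _ => by positivity
          simp only [fourCycleFreeOn, Finset.mem_filter, Finset.mem_univ, true_and] at hG ⊢
          exact ⟨(mem_sparseFourCycleFree.1 hG).1, fun _ _ _ => trivial⟩
  have hl0 : 0 < Real.log n := Real.log_pos (by linarith)
  have hbase : (n : ℝ) * ((n + 1) * Real.exp (c / 2 * Real.sqrt n))
      ≤ Real.exp (c * Real.sqrt n) := by
    have h5 : (n : ℝ) * (n + 1) ≤ Real.exp (c / 2 * Real.sqrt n) := by
      calc (n : ℝ) * (n + 1) ≤ (n * n) * (n * n) := by
            gcongr <;> nlinarith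
        _ = Real.exp (4 * Real.log n) := by
          rw [show 4 * Real.log n = (Real.log n + Real.log n) + (Real.log n + Real.log n) by ring,
            Real.exp_add, Real.exp_add, Real.exp_log hn0]
        _ ≤ _ := by
          rw [Real.exp_le_exp]
          have : 0 ≤ 16 * Real.log n ^ 4 / (c / 4) ^ 2 := by positivity
          linarith
    calc (n : ℝ) * ((n + 1) * Real.exp (c / 2 * Real.sqrt n))
        = n * (n + 1) * Real.exp (c / 2 * Real.sqrt n) := by ring
      _ ≤ Real.exp (c / 2 * Real.sqrt n) * Real.exp (c / 2 * Real.sqrt n) := by gcongr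
      _ = _ := by rw [← Real.exp_add]; congr 1; ring
  have hpow : ((n : ℝ) * ((n + 1) * Real.exp (c / 2 * Real.sqrt n))) ^ n
      ≤ Real.exp (c * (n : ℝ) ^ (3 / 2 : ℝ)) := by
    calc _ ≤ Real.exp (c * Real.sqrt n) ^ n := by gcongr
      _ = Real.exp (c * (n : ℝ) ^ (3 / 2 : ℝ)) := by
        rw [← Real.exp_nat_mul]
        congr 1
        rw [show (3 / 2 : ℝ) = 1 + 1 / 2 by norm_num, Real.rpow_add hn0, Real.rpow_one,
          Real.sqrt_eq_rpow]
        ring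
  have hfin := (hlow.trans hcnt).trans hpow
  rw [Real.exp_add]
  have hLm : Real.exp (Real.log L * m) = L ^ m := by
    rw [mul_comm, Real.exp_nat_mul, Real.exp_log hL0]
  rw [hLm]
  calc (C.card : ℝ) = C.card * L⁻¹ ^ m * L ^ m := by
        rw [inv_pow]; field_simp
    _ ≤ _ := by gcongr

end CountFourCycleFree

/-! ### Weak regularity for sparse matrices with small codegrees. -/

section WeakRegularity

open scoped Classical

variable {V : Type*} [Fintype V]

/-- The averaging kernel of a colouring. -/
noncomputable def avgKernel {ι : Type*} (c : V → ι) (x y : V) : ℝ :=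
  if c x = c y then ((Finset.univ.filter fun z => c z = c x).card : ℝ)⁻¹ else 0

/-- The average of `a` over the products of colour classes. -/
noncomputable def colorAvg {ι : Type*} (c : V → ι) (a : V → V → ℝ) (x y : V) : ℝ :=
  ∑ y', avgKernel c y y' * ∑ x', avgKernel c x x' * a x' y'

/-- The `L²` energy of a colouring. -/
noncomputable def colorEnergy {ι : Type*} (c : V → ι) (a : V → V → ℝ) : ℝ :=
  ∑ x, ∑ y, colorAvg c a x y ^ 2

variable {ι : Type*} (c : V → ι) (a : V → V → ℝ)

theorem avgKernel_nonneg (x y : V) : 0 ≤ avgKernel c x y := by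
  unfold avgKernel; split_ifs <;> positivity

theorem avgKernel_comm (x y : V) : avgKernel c x y = avgKernel c y x := by
  unfold avgKernel
  split_ifs with h1 h2 h2
  · rw [h1]
  · exact absurd h1.symm h2
  · exact absurd h2.symm h1
  · rfl

theorem avgKernel_congr {x x' : V} (h : c x = c x') : avgKernel c x = avgKernel c x' := by
  funext y; unfold avgKernel; rw [h]

theorem sum_avgKernel (x : V) : ∑ y, avgKernel c x y = 1 := by
  unfold avgKernel
  rw [← Finset.sum_filter, Finset.sum_const, nsmul_eq_mul]
  simp_rw [eq_comm (a := c x)]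
  refine mul_inv_cancel₀ ?_
  have : 0 < (Finset.univ.filter fun z => c z = c x).card :=
    Finset.card_pos.2 ⟨x, by simp⟩
  positivity

theorem sum_avgKernel' (y : V) : ∑ x, avgKernel c x y = 1 := by
  simp_rw [avgKernel_comm c _ y, sum_avgKernel]

theorem avgKernel_mul_congr {x y : V} {p q : ℝ} (h : c x = c y → p = q) :
    avgKernel c x y * p = avgKernel c x y * q := by
  by_cases hc : c x = c y
  · rw [h hc]
  · simp [avgKernel, hc]

theorem colorAvg_congr {x x' y y' : V} (hx : c x = c x') (hy : c y = c y') :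
    colorAvg c a x y = colorAvg c a x' y' := by
  unfold colorAvg; rw [avgKernel_congr c hx, avgKernel_congr c hy]

theorem colorAvg_nonneg (ha : ∀ x y, 0 ≤ a x y) (x y : V) : 0 ≤ colorAvg c a x y :=
  Finset.sum_nonneg fun _ _ => mul_nonneg (avgKernel_nonneg c _ _) <|
    Finset.sum_nonneg fun _ _ => mul_nonneg (avgKernel_nonneg c _ _) (ha _ _)

theorem colorAvg_comm (ha : ∀ x y, a x y = a y x) (x y : V) :
    colorAvg c a x y = colorAvg c a y x := by
  unfold colorAvg
  simp_rw [Finset.mul_sum]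
  rw [Finset.sum_comm]
  refine Finset.sum_congr rfl fun u _ => Finset.sum_congr rfl fun v _ => ?_
  rw [ha u v]; ring

/-- Averaging over colour classes is self-adjoint against functions of the colours. -/
theorem sum_colorAvg_mul (φ : V → V → ℝ)
    (hφ : ∀ x x' y y', c x = c x' → c y = c y' → φ x y = φ x' y') :
    ∑ x, ∑ y, colorAvg c a x y * φ x y = ∑ x, ∑ y, a x y * φ x y := by
  have h1 : ∀ x y, colorAvg c a x y * φ x y
      = ∑ y', ∑ x', avgKernel c x x' * (avgKernel c y y' * (a x' y' * φ x' y')) := by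
    intro x y
    unfold colorAvg
    rw [Finset.sum_mul]
    refine Finset.sum_congr rfl fun y' _ => ?_
    rw [Finset.mul_sum, Finset.sum_mul]
    refine Finset.sum_congr rfl fun x' _ => ?_
    have h2 : avgKernel c x x' * φ x y = avgKernel c x x' * φ x' y :=
      avgKernel_mul_congr c fun h => hφ _ _ _ _ h rfl
    have h3 : avgKernel c y y' * φ x' y = avgKernel c y y' * φ x' y' :=
      avgKernel_mul_congr c fun h => hφ _ _ _ _ rfl h
    linear_combination (avgKernel c y y' * a x' y') * h2 + (avgKernel c x x' * a x' y') * h3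
  simp_rw [h1]
  calc ∑ x, ∑ y, ∑ y', ∑ x', avgKernel c x x' * (avgKernel c y y' * (a x' y' * φ x' y'))
      = ∑ x, ∑ y', ∑ x', ∑ y, avgKernel c x x' * (avgKernel c y y' * (a x' y' * φ x' y')) := by
        refine Finset.sum_congr rfl fun x _ => ?_
        rw [Finset.sum_comm]
        exact Finset.sum_congr rfl fun y' _ => Finset.sum_comm
    _ = ∑ x, ∑ y', ∑ x', avgKernel c x x' * (a x' y' * φ x' y') := by
        simp_rw [← Finset.mul_sum, ← Finset.sum_mul, sum_avgKernel', one_mul]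
    _ = ∑ y', ∑ x', ∑ x, avgKernel c x x' * (a x' y' * φ x' y') := by
        rw [Finset.sum_comm]
        exact Finset.sum_congr rfl fun y' _ => Finset.sum_comm
    _ = ∑ y', ∑ x', a x' y' * φ x' y' := by
        simp_rw [← Finset.sum_mul, sum_avgKernel', one_mul]
    _ = _ := Finset.sum_comm

theorem sq_sum_avgKernel_le (f : V → ℝ) (x : V) :
    (∑ y, avgKernel c x y * f y) ^ 2 ≤ ∑ y, avgKernel c x y * f y ^ 2 := by
  have := (even_two.convexOn_pow (𝕜 := ℝ)).map_sum_le (t := Finset.univ)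
    (w := fun y => avgKernel c x y) (p := f) (fun y _ => avgKernel_nonneg c x y)
    (sum_avgKernel c x) (fun _ _ => Set.mem_univ _)
  simpa using this

/-- Each nonempty colour class contributes exactly 1. -/
theorem sum_avgKernel_self [Fintype ι] : ∑ x, avgKernel c x x ≤ Fintype.card ι := by
  have h : ∀ i : ι, ∑ x ∈ Finset.univ.filter (fun x => c x = i), avgKernel c x x ≤ 1 := by
    intro i
    have h1 : ∀ x ∈ Finset.univ.filter (fun x => c x = i), avgKernel c x x
        = ((Finset.univ.filter fun z => c z = i).card : ℝ)⁻¹ := by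
      intro x hx
      rw [Finset.mem_filter] at hx
      simp [avgKernel, hx.2]
    rw [Finset.sum_congr rfl h1, Finset.sum_const, nsmul_eq_mul]
    exact mul_inv_le_one
  calc ∑ x, avgKernel c x x = ∑ i : ι, ∑ x ∈ Finset.univ.filter (fun x => c x = i),
        avgKernel c x x := (Finset.sum_fiberwise _ _ _).symm
    _ ≤ ∑ _i : ι, (1 : ℝ) := Finset.sum_le_sum fun i _ => h i
    _ = _ := by simp

/-- By convexity, averaging the second variable does not increase the energy. Expanding the square
of the average in the first variable produces codegrees: off-diagonal ones are at most 1 and give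
|V| in total, and diagonal ones give at most D per colour. This linear bound is what makes
regularity available for a graph with only O(n^{3/2}) edges. -/
theorem colorEnergy_le [Fintype ι] {D : ℝ}
    (hcod : ∀ x y, x ≠ y → ∑ u, a x u * a y u ≤ 1) (hdeg : ∀ x, ∑ u, a x u * a x u ≤ D)
    (hD : 0 ≤ D) :
    colorEnergy c a ≤ Fintype.card V + D * Fintype.card ι := by
  let B : V → V → ℝ := fun x u => ∑ x', avgKernel c x x' * a x' u
  have h1 : ∀ x, ∑ y, colorAvg c a x y ^ 2 ≤ ∑ u, B x u ^ 2 := by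
    intro x
    calc ∑ y, colorAvg c a x y ^ 2 ≤ ∑ y, ∑ u, avgKernel c y u * B x u ^ 2 :=
          Finset.sum_le_sum fun y _ => sq_sum_avgKernel_le c (B x) y
      _ = ∑ u, B x u ^ 2 := by
          rw [Finset.sum_comm]
          simp_rw [← Finset.sum_mul, sum_avgKernel', one_mul]
  have h2 : ∀ x, ∑ u, B x u ^ 2 ≤ 1 + D * avgKernel c x x := by
    intro x
    calc ∑ u, B x u ^ 2
        = ∑ u, ∑ y, ∑ z, avgKernel c x y * avgKernel c x z * (a y u * a z u) := by
          refine Finset.sum_congr rfl fun u _ => ?_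
          simp only [B]
          rw [sq, Finset.sum_mul_sum]
          refine Finset.sum_congr rfl fun y _ => Finset.sum_congr rfl fun z _ => ?_
          ring
      _ = ∑ y, ∑ z, avgKernel c x y * avgKernel c x z * ∑ u, a y u * a z u := by
          rw [Finset.sum_comm]
          refine Finset.sum_congr rfl fun y _ => ?_
          rw [Finset.sum_comm]
          simp_rw [Finset.mul_sum]
      _ ≤ ∑ y, ∑ z, avgKernel c x y * avgKernel c x z * (1 + if y = z then D else 0) := by
          refine Finset.sum_le_sum fun y _ => Finset.sum_le_sum fun z _ => ?_
          refine mul_le_mul_of_nonneg_left ?_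
            (mul_nonneg (avgKernel_nonneg c _ _) (avgKernel_nonneg c _ _))
          split_ifs with h
          · subst h; linarith [hdeg y]
          · simpa using hcod y z h
      _ = 1 + D * ∑ y, avgKernel c x y * avgKernel c x y := by
          simp_rw [mul_add, mul_one, Finset.sum_add_distrib, ← Finset.mul_sum, sum_avgKernel,
            mul_one, sum_avgKernel]
          congr 1
          simp only [mul_ite, mul_zero, Finset.sum_ite_eq, Finset.mem_univ, if_true]
          rw [Finset.mul_sum]
          exact Finset.sum_congr rfl fun y _ => mul_comm _ _
      _ = 1 + D * avgKernel c x x := by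
          have h3 : ∀ y, avgKernel c x y * avgKernel c x y
              = avgKernel c x y * avgKernel c x x := fun y =>
            avgKernel_mul_congr c fun h => by simp [avgKernel, h]
          simp_rw [h3, ← Finset.sum_mul, sum_avgKernel, one_mul]
  calc colorEnergy c a ≤ ∑ x, (1 + D * avgKernel c x x) :=
        Finset.sum_le_sum fun x _ => (h1 x).trans (h2 x)
    _ = Fintype.card V + D * ∑ x, avgKernel c x x := by
        rw [Finset.sum_add_distrib, ← Finset.mul_sum]; simp
    _ ≤ _ := by gcongr; exact sum_avgKernel_self c

/-- As S and T are unions of classes of c', averaging over c' preserves the sum over S × T.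
Cauchy–Schwarz compares the two averages, and Pythagoras turns their squared distance into the
energy difference. -/
theorem sq_le_colorEnergy_sub {ι' : Type*} (c' : V → ι')
    (href : ∀ x y, c' x = c' y → c x = c y) (S T : Finset V)
    (hS : ∀ x y, c' x = c' y → (x ∈ S ↔ y ∈ S)) (hT : ∀ x y, c' x = c' y → (x ∈ T ↔ y ∈ T)) :
    (∑ x ∈ S, ∑ y ∈ T, (colorAvg c a x y - a x y)) ^ 2
      ≤ (Fintype.card V : ℝ) ^ 2 * (colorEnergy c' a - colorEnergy c a) := by
  let φ : V → V → ℝ := fun x y => (if x ∈ S then 1 else 0) * (if y ∈ T then 1 else 0)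
  have hφ : ∀ b : V → V → ℝ, ∑ x ∈ S, ∑ y ∈ T, b x y = ∑ x, ∑ y, b x y * φ x y := by
    intro b
    have h1 : ∀ x, ∑ y, b x y * φ x y = if x ∈ S then ∑ y ∈ T, b x y else 0 := by
      intro x
      by_cases hx : x ∈ S <;> simp [φ, hx]
    simp_rw [h1]
    simp
  have hφ1 := sum_colorAvg_mul c' a φ fun x x' y y' hx hy => by
    simp only [φ, hS x x' hx, hT y y' hy]
  have h1 : ∑ x ∈ S, ∑ y ∈ T, (colorAvg c a x y - a x y)
      = ∑ x, ∑ y, (colorAvg c a x y - colorAvg c' a x y) * φ x y := by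
    rw [hφ]
    simp_rw [sub_mul, Finset.sum_sub_distrib]
    rw [hφ1]
  have h2 : ∑ x, ∑ y, (colorAvg c a x y - colorAvg c' a x y) ^ 2
      = colorEnergy c' a - colorEnergy c a := by
    have h3 := sum_colorAvg_mul c' a (colorAvg c a) fun x x' y y' hx hy =>
      colorAvg_congr c a (href _ _ hx) (href _ _ hy)
    have h4 := sum_colorAvg_mul c a (colorAvg c a) fun x x' y y' hx hy =>
      colorAvg_congr c a hx hy
    have h5 : ∑ x, ∑ y, (colorAvg c a x y - colorAvg c' a x y) ^ 2
        = colorEnergy c a - 2 * ∑ x, ∑ y, colorAvg c' a x y * colorAvg c a x y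
          + colorEnergy c' a := by
      unfold colorEnergy
      simp_rw [Finset.mul_sum, ← Finset.sum_sub_distrib, ← Finset.sum_add_distrib]
      refine Finset.sum_congr rfl fun x _ => Finset.sum_congr rfl fun y _ => ?_
      ring
    have h6 : ∑ x, ∑ y, colorAvg c a x y * colorAvg c a x y = colorEnergy c a := by
      unfold colorEnergy; simp_rw [sq]
    rw [h5, h3, ← h4, h6]; ring
  rw [h1, ← h2]
  simp_rw [← Fintype.sum_prod_type' (f := fun x y => (colorAvg c a x y - colorAvg c' a x y) ^ 2),
    ← Fintype.sum_prod_type' (f := fun x y => (colorAvg c a x y - colorAvg c' a x y) * φ x y)]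
  refine (Finset.sum_mul_sq_le_sq_mul_sq _ _ _).trans ?_
  rw [mul_comm]
  gcongr
  calc ∑ p : V × V, φ p.1 p.2 ^ 2 ≤ ∑ _p : V × V, (1 : ℝ) := by
        refine Finset.sum_le_sum fun p _ => ?_
        simp only [φ]
        split_ifs <;> norm_num
    _ = _ := by simp [sq]

/-- Energy increment: splitting the colours by a violating pair S, T multiplies their number by four
and raises the energy by at least t²/|V|². -/
theorem exists_regular_or_energy {t : ℝ} (ht : 0 ≤ t) (j : ℕ) :
    ∃ (ι : Type) (_ : Fintype ι) (c : V → ι), Fintype.card ι ≤ 4 ^ j ∧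
      ((∀ S T : Finset V, ∑ x ∈ S, ∑ y ∈ T, (colorAvg c a x y - a x y) ≤ t) ∨
        j * t ^ 2 ≤ (Fintype.card V : ℝ) ^ 2 * colorEnergy c a) := by
  induction j with
  | zero =>
    refine ⟨Unit, inferInstance, fun _ => (), by simp, Or.inr ?_⟩
    have : 0 ≤ colorEnergy (fun _ : V => ()) a :=
      Finset.sum_nonneg fun _ _ => Finset.sum_nonneg fun _ _ => sq_nonneg _
    simpa using by positivity
  | succ j ih =>
    obtain ⟨ι, _, c, hι, h⟩ := ih
    have hle : 4 ^ j ≤ 4 ^ (j + 1) := Nat.pow_le_pow_right (by norm_num) (by omega)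
    by_cases hreg : ∀ S T : Finset V, ∑ x ∈ S, ∑ y ∈ T, (colorAvg c a x y - a x y) ≤ t
    · exact ⟨ι, inferInstance, c, hι.trans hle, Or.inl hreg⟩
    · have hE := h.resolve_left hreg
      push Not at hreg
      obtain ⟨S, T, hST⟩ := hreg
      refine ⟨ι × Bool × Bool, inferInstance, fun x => (c x, decide (x ∈ S), decide (x ∈ T)),
        ?_, Or.inr ?_⟩
      · simp only [Fintype.card_prod, Fintype.card_bool]
        rw [pow_succ]
        omega
      · have h1 := sq_le_colorEnergy_sub c a
          (fun x => (c x, decide (x ∈ S), decide (x ∈ T)))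
          (fun x y hxy => (Prod.ext_iff.1 hxy).1) S T
          (fun x y hxy => by simpa using (Prod.ext_iff.1 (Prod.ext_iff.1 hxy).2).1)
          (fun x y hxy => by simpa using (Prod.ext_iff.1 (Prod.ext_iff.1 hxy).2).2)
        have h2 : t ^ 2 ≤ (∑ x ∈ S, ∑ y ∈ T, (colorAvg c a x y - a x y)) ^ 2 := by gcongr
        push_cast
        linarith

/-- A linear functional on the cube is maximised at a vertex, here the set where h is positive. -/
theorem exists_sum_mul_le_sum (f h : V → ℝ) (hf0 : ∀ x, 0 ≤ f x) (hf1 : ∀ x, f x ≤ 1) :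
    ∃ S : Finset V, ∑ x, f x * h x ≤ ∑ x ∈ S, h x := by
  refine ⟨Finset.univ.filter fun x => 0 < h x, ?_⟩
  rw [Finset.sum_filter]
  refine Finset.sum_le_sum fun x _ => ?_
  split_ifs with hx
  · exact mul_le_of_le_one_left hx.le (hf1 x)
  · exact mul_nonpos_of_nonneg_of_nonpos (hf0 x) (not_lt.1 hx)

/-- A cut-norm bound extends from sets to functions with values in the unit interval. -/
theorem sum_sum_mul_le_of_cut {b : V → V → ℝ} {t : ℝ}
    (hb : ∀ S T : Finset V, ∑ x ∈ S, ∑ y ∈ T, b x y ≤ t) (f g : V → ℝ)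
    (hf0 : ∀ x, 0 ≤ f x) (hf1 : ∀ x, f x ≤ 1) (hg0 : ∀ x, 0 ≤ g x) (hg1 : ∀ x, g x ≤ 1) :
    ∑ x, ∑ y, f x * b x y * g y ≤ t := by
  obtain ⟨S, hS⟩ := exists_sum_mul_le_sum f (fun x => ∑ y, b x y * g y) hf0 hf1
  obtain ⟨T, hT⟩ := exists_sum_mul_le_sum g (fun y => ∑ x ∈ S, b x y) hg0 hg1
  calc ∑ x, ∑ y, f x * b x y * g y = ∑ x, f x * ∑ y, b x y * g y := by
        simp_rw [Finset.mul_sum, mul_assoc]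
    _ ≤ ∑ x ∈ S, ∑ y, b x y * g y := hS
    _ = ∑ y, g y * ∑ x ∈ S, b x y := by
        rw [Finset.sum_comm]
        simp_rw [Finset.mul_sum, mul_comm]
    _ ≤ ∑ y ∈ T, ∑ x ∈ S, b x y := hT
    _ ≤ t := by rw [Finset.sum_comm]; exact hb S T

end WeakRegularity

/-! ### A counting lemma for closed walks of length five. -/

section FiveWalks

open scoped Classical

variable {V : Type*} [Fintype V]

theorem entry_mul_nonneg {P Q : Matrix V V ℝ} (hP : ∀ x y, 0 ≤ P x y) (hQ : ∀ x y, 0 ≤ Q x y)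
    (x y : V) : 0 ≤ (P * Q) x y :=
  Finset.sum_nonneg fun _ _ => mul_nonneg (hP _ _) (hQ _ _)

theorem entry_mul_le {P Q : Matrix V V ℝ} {α β : ℝ} (hP : ∀ x y, 0 ≤ P x y)
    (hPα : ∀ x, ∑ y, P x y ≤ α) (hQ : ∀ x y, Q x y ≤ β) (hβ : 0 ≤ β) (x y : V) :
    (P * Q) x y ≤ α * β := by
  calc (P * Q) x y = ∑ u, P x u * Q u y := rfl
    _ ≤ ∑ u, P x u * β := Finset.sum_le_sum fun u _ => mul_le_mul_of_nonneg_left (hQ _ _) (hP _ _)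
    _ = (∑ u, P x u) * β := by rw [Finset.sum_mul]
    _ ≤ _ := by gcongr; exact hPα x

theorem sum_row_le {P : Matrix V V ℝ} {α : ℝ} (hP : ∀ x y, P x y ≤ α) (x : V) :
    ∑ y, P x y ≤ Fintype.card V * α := by
  calc ∑ y, P x y ≤ ∑ _y : V, α := Finset.sum_le_sum fun y _ => hP x y
    _ = _ := by simp

/-- If `A` dominates `ρ R` in cut norm up to `t`, then one factor `A` of a trace can be replaced. -/
theorem trace_mul_mul_ge {A R : Matrix V V ℝ} {ρ t : ℝ}
    (hcut : ∀ f g : V → ℝ, (∀ x, 0 ≤ f x) → (∀ x, f x ≤ 1) → (∀ x, 0 ≤ g x) → (∀ x, g x ≤ 1) →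
      ρ * (∑ x, ∑ y, f x * R x y * g y) - t ≤ ∑ x, ∑ y, f x * A x y * g y)
    {P Q : Matrix V V ℝ} {α β : ℝ} (hα : 0 < α) (hβ : 0 < β)
    (hP0 : ∀ x y, 0 ≤ P x y) (hP1 : ∀ x y, P x y ≤ α)
    (hQ0 : ∀ x y, 0 ≤ Q x y) (hQ1 : ∀ x y, Q x y ≤ β) :
    ρ * (P * R * Q).trace - Fintype.card V * (α * β * t) ≤ (P * A * Q).trace := by
  -- For each i, row i of P and column i of Q, rescaled by α and β, serve as test functions.
  have hexp : ∀ M : Matrix V V ℝ, (P * M * Q).trace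
      = ∑ i, α * β * ∑ x, ∑ y, P i x / α * M x y * (Q y i / β) := by
    intro M
    rw [Matrix.trace]
    refine Finset.sum_congr rfl fun i _ => ?_
    simp only [Matrix.diag_apply, Matrix.mul_apply, Finset.sum_mul, Finset.mul_sum]
    rw [Finset.sum_comm]
    refine Finset.sum_congr rfl fun x _ => Finset.sum_congr rfl fun y _ => ?_
    field_simp
  rw [hexp, hexp]
  calc _ = ∑ i, α * β * (ρ * (∑ x, ∑ y, P i x / α * R x y * (Q y i / β)) - t) := by
        simp_rw [mul_sub, Finset.sum_sub_distrib]
        rw [Finset.mul_sum]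
        congr 1
        · exact Finset.sum_congr rfl fun i _ => by ring
        · simp
    _ ≤ _ := by
        refine Finset.sum_le_sum fun i _ => ?_
        refine mul_le_mul_of_nonneg_left (hcut _ _ ?_ ?_ ?_ ?_) (by positivity)
        · exact fun x => div_nonneg (hP0 _ _) hα.le
        · exact fun x => (div_le_one hα).2 (hP1 _ _)
        · exact fun x => div_nonneg (hQ0 _ _) hβ.le
        · exact fun x => (div_le_one hβ).2 (hQ1 _ _)

/-- Counting closed walks of length five in a matrix with small codegrees that dominates `ρ R` in
cut norm. -/
theorem trace_pow_five_ge {A R : Matrix V V ℝ} {ρ t D : ℝ} (hρ : 0 ≤ ρ) (hD : 0 < D)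
    (hn : 0 < Fintype.card V)
    (hcut : ∀ f g : V → ℝ, (∀ x, 0 ≤ f x) → (∀ x, f x ≤ 1) → (∀ x, 0 ≤ g x) → (∀ x, g x ≤ 1) →
      ρ * (∑ x, ∑ y, f x * R x y * g y) - t ≤ ∑ x, ∑ y, f x * A x y * g y)
    (hA0 : ∀ x y, 0 ≤ A x y) (hcod : ∀ x y, x ≠ y → (A * A) x y ≤ 1)
    (hdiag : ∀ x, (A * A) x x ≤ D) (hdeg : ∀ x, ∑ y, A x y ≤ D)
    (hR0 : ∀ x y, 0 ≤ R x y) (hR1 : ∀ x y, R x y ≤ 1) :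
    ρ ^ 5 * (R * R * R * R * R).trace
      - (ρ ^ 4 * (Fintype.card V ^ 3 * t) + ρ ^ 3 * (Fintype.card V ^ 2 * D * t)
        + ρ ^ 3 * (Fintype.card V ^ 3 * D) + ρ ^ 2 * (Fintype.card V ^ 2 * t)
        + ρ * (Fintype.card V * D * t) + ρ * (Fintype.card V ^ 2 * D) + Fintype.card V * t)
      ≤ (A * A * A * A * A).trace := by
  set n : ℝ := (Fintype.card V : ℝ) with hndef
  have hn0 : 0 < n := by rw [hndef]; exact_mod_cast hn
  -- Splitting off the diagonal of A² leaves Γ with entries at most 1. Test functions built from Γ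
  -- then cost only t per row, while those involving the row sums of A cost D t.
  let Δ : Matrix V V ℝ := Matrix.diagonal fun x => (A * A) x x
  let Γ : Matrix V V ℝ := A * A - Δ
  have hAA : A * A = Γ + Δ := by simp [Γ]
  have hΔ0 : ∀ x y, 0 ≤ Δ x y := fun x y => by
    by_cases h : x = y
    · subst h; simpa [Δ] using entry_mul_nonneg hA0 hA0 x x
    · simp [Δ, h]
  have hΓ0 : ∀ x y, 0 ≤ Γ x y := fun x y => by
    by_cases h : x = y
    · subst h; simp [Γ, Δ]
    · simpa [Γ, Δ, h] using entry_mul_nonneg hA0 hA0 x y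
  have hΓ1 : ∀ x y, Γ x y ≤ 1 := fun x y => by
    by_cases h : x = y
    · subst h; simp [Γ, Δ]
    · simpa [Γ, Δ, h] using hcod x y h
  have tr_nonneg : ∀ M : Matrix V V ℝ, (∀ x y, 0 ≤ M x y) → 0 ≤ M.trace := fun M hM =>
    Finset.sum_nonneg fun x _ => hM x x
  have tr_le : ∀ (M : Matrix V V ℝ) (β : ℝ), (∀ x y, M x y ≤ β) → M.trace ≤ n * β := by
    intro M β hM
    calc M.trace = ∑ x, M x x := rfl
      _ ≤ ∑ _x : V, β := Finset.sum_le_sum fun x _ => hM x x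
      _ = _ := by simp [hndef]
  have hRR0 := entry_mul_nonneg hR0 hR0
  have hRs : ∀ x, ∑ y, R x y ≤ n := fun x => by simpa using sum_row_le hR1 x
  have hRR1 : ∀ x y, (R * R) x y ≤ n := fun x y => by
    simpa using entry_mul_le hR0 hRs hR1 zero_le_one x y
  have hRRR0 := entry_mul_nonneg hRR0 hR0
  have hRRs : ∀ x, ∑ y, (R * R) x y ≤ n * n := sum_row_le hRR1
  have hRRR1 : ∀ x y, (R * R * R) x y ≤ n * n := fun x y => by
    simpa using entry_mul_le hRR0 hRRs hR1 zero_le_one x y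
  have s0 : (Γ * A * Γ).trace ≤ (A * A * A * A * A).trace := by
    have e : A * A * A * A * A = Γ * A * Γ + (Γ * A * Δ + Δ * A * Γ + Δ * A * Δ) := by
      rw [show A * A * A * A * A = (A * A) * A * (A * A) by noncomm_ring, hAA]
      noncomm_ring
    rw [e, Matrix.trace_add]
    have := tr_nonneg (Γ * A * Δ + Δ * A * Γ + Δ * A * Δ) fun x y => by
      have h1 := entry_mul_nonneg (entry_mul_nonneg hΓ0 hA0) hΔ0 x y
      have h2 := entry_mul_nonneg (entry_mul_nonneg hΔ0 hA0) hΓ0 x y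
      have h3 := entry_mul_nonneg (entry_mul_nonneg hΔ0 hA0) hΔ0 x y
      simp only [Matrix.add_apply]
      positivity
    linarith
  have s1 := trace_mul_mul_ge hcut one_pos one_pos hΓ0 hΓ1 hΓ0 hΓ1
  have e1 : (Γ * R * Γ).trace = (R * A * (A * Γ)).trace - (Γ * R * Δ).trace := by
    rw [show Γ * R * Γ = Γ * R * (A * A) - Γ * R * Δ by rw [hAA]; noncomm_ring,
      Matrix.trace_sub]
    congr 1
    rw [show Γ * R * (A * A) = Γ * (R * A * A) by noncomm_ring, Matrix.trace_mul_comm]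
    congr 1
    noncomm_ring
  have b1 : (Γ * R * Δ).trace ≤ n * (n * D) := by
    refine tr_le _ _ fun x y => ?_
    have h1 : ∀ x y, (R * Δ) x y ≤ D := fun x y => by
      rw [Matrix.mul_apply]
      simp only [Δ, Matrix.diagonal_apply, mul_ite, mul_zero, Finset.sum_ite_eq', Finset.mem_univ,
        if_true]
      have h0 := entry_mul_nonneg hA0 hA0 y y
      nlinarith [hR1 x y, hR0 x y, hdiag y]
    rw [mul_assoc]
    exact entry_mul_le hΓ0 (fun x => by simpa using sum_row_le hΓ1 x) h1 hD.le x y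
  have s2 := trace_mul_mul_ge hcut one_pos hD hR0 hR1 (entry_mul_nonneg hA0 hΓ0)
    (fun x y => by simpa using entry_mul_le hA0 hdeg hΓ1 zero_le_one x y)
  have e2 : R * R * (A * Γ) = (R * R) * A * Γ := by noncomm_ring
  have s3 := trace_mul_mul_ge hcut hn0 one_pos hRR0 hRR1 hΓ0 hΓ1
  have e3 : (R * R * R * Γ).trace = (R * R * A * (A * R)).trace - (R * R * R * Δ).trace := by
    rw [show R * R * R * Γ = R * R * R * (A * A) - R * R * R * Δ by rw [hAA]; noncomm_ring,
      Matrix.trace_sub]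
    congr 1
    rw [show R * R * R * (A * A) = R * (R * R * A * A) by noncomm_ring, Matrix.trace_mul_comm]
    congr 1
    noncomm_ring
  have b3 : (R * R * R * Δ).trace ≤ n * (n * n * D) := by
    refine tr_le _ _ fun x y => ?_
    rw [Matrix.mul_apply]
    simp only [Δ, Matrix.diagonal_apply, mul_ite, mul_zero, Finset.sum_ite_eq', Finset.mem_univ,
      if_true]
    exact mul_le_mul (hRRR1 x y) (hdiag y) (entry_mul_nonneg hA0 hA0 y y) (by positivity)
  have s4 := trace_mul_mul_ge hcut hn0 hD hRR0 hRR1 (entry_mul_nonneg hA0 hR0)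
    (fun x y => by simpa using entry_mul_le hA0 hdeg hR1 zero_le_one x y)
  have e4 : R * R * R * (A * R) = (R * R * R) * A * R := by noncomm_ring
  have s5 := trace_mul_mul_ge hcut (show 0 < n * n by positivity) one_pos hRRR0 hRRR1 hR0 hR1
  rw [e1] at s1
  rw [e2] at s2
  rw [e3] at s3
  rw [e4] at s4
  rw [← hndef] at s1 s2 s3 s4 s5
  -- Assemble backwards the replacement chain ΓAΓ → ΓRΓ → RRAΓ → RRRΓ → RRRAR → RRRRR, one factor A
  -- becoming ρR at each arrow. Unfolding Γ as A² - Δ before the second and fourth replacements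
  -- costs the traces with Δ.
  have c4 := mul_le_mul_of_nonneg_left s5 hρ
  have d4 := sub_le_sub ((sub_le_sub_right c4 _).trans s4) b3
  have d3 := (sub_le_sub_right (mul_le_mul_of_nonneg_left d4 hρ) _).trans s3
  have d2 := (sub_le_sub_right (mul_le_mul_of_nonneg_left d3 hρ) _).trans s2
  have d1 := (sub_le_sub_right (mul_le_mul_of_nonneg_left (sub_le_sub d2 b1) hρ) _).trans s1
  refine le_trans (le_of_eq ?_) (d1.trans s0)
  ring

end FiveWalks

/-! ### Closed five-walks: many when triangles abound, few without C4 and C5. -/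

section FiveWalkBounds

open scoped Classical

variable {V : Type*} [Fintype V]

/-- A lower bound for the number of walks of length three in terms of the number of edges. -/
theorem sum_cube_le_three_walks (q : V → V → ℝ) (hq0 : ∀ x y, 0 ≤ q x y)
    (hqs : ∀ x y, q x y = q y x) (hn : 0 < Fintype.card V) :
    (∑ x, ∑ y, q x y) ^ 3
      ≤ 32 * (Fintype.card V : ℝ) ^ 2 * ∑ x, ∑ y, (∑ u, q x u) * q x y * (∑ u, q y u) := by
  set n : ℝ := (Fintype.card V : ℝ) with hndef
  have hn0 : 0 < n := by rw [hndef]; exact_mod_cast hn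
  set m := ∑ x, ∑ y, q x y with hm
  let d : V → ℝ := fun x => ∑ u, q x u
  have hd0 : ∀ x, 0 ≤ d x := fun x => Finset.sum_nonneg fun _ _ => hq0 _ _
  have hm0 : 0 ≤ m := Finset.sum_nonneg fun x _ => hd0 x
  -- A quarter of the average degree: edges at vertices of degree below θ carry at most m/4 for each
  -- end, so half the mass survives, and θ² m/2 = m³/(32 n²).
  set θ := m / (4 * n) with hθ
  have hθ0 : 0 ≤ θ := by positivity
  let low : V → ℝ := fun x => if d x < θ then 1 else 0
  have h1 : ∀ x y, q x y * θ ^ 2 * (1 - low x - low y) ≤ d x * q x y * d y := by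
    intro x y
    have h2 : θ ^ 2 * (1 - low x - low y) ≤ d x * d y := by
      have hxy := mul_nonneg (hd0 x) (hd0 y)
      simp only [low]
      split_ifs with hx hy hy
      · nlinarith [sq_nonneg θ]
      · nlinarith [sq_nonneg θ]
      · nlinarith [sq_nonneg θ]
      · have := mul_le_mul (not_lt.1 hx) (not_lt.1 hy) hθ0 (hd0 x)
        nlinarith
    nlinarith [mul_le_mul_of_nonneg_left h2 (hq0 x y)]
  have h3 : ∑ x, ∑ y, q x y * low x ≤ n * θ := by
    calc ∑ x, ∑ y, q x y * low x = ∑ x, d x * low x := by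
          simp only [d, Finset.sum_mul]
      _ ≤ ∑ _x : V, θ := by
          refine Finset.sum_le_sum fun x _ => ?_
          simp only [low]
          split_ifs with hx
          · linarith
          · simpa using hθ0
      _ = n * θ := by simp [hndef]
  have h4 : ∑ x, ∑ y, q x y * low y = ∑ x, ∑ y, q x y * low x := by
    rw [Finset.sum_comm]
    simp_rw [hqs]
  have h5 : θ ^ 2 * (m - 2 * (n * θ)) ≤ ∑ x, ∑ y, d x * q x y * d y := by
    calc θ ^ 2 * (m - 2 * (n * θ))
        ≤ θ ^ 2 * (m - ∑ x, ∑ y, q x y * low x - ∑ x, ∑ y, q x y * low y) := by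
          refine mul_le_mul_of_nonneg_left ?_ (sq_nonneg θ)
          linarith
      _ = ∑ x, ∑ y, q x y * θ ^ 2 * (1 - low x - low y) := by
          rw [hm]
          simp_rw [← Finset.sum_sub_distrib, Finset.mul_sum]
          refine Finset.sum_congr rfl fun x _ => Finset.sum_congr rfl fun y _ => ?_
          ring
      _ ≤ _ := Finset.sum_le_sum fun x _ => Finset.sum_le_sum fun y _ => h1 x y
  have h6 : m ^ 3 = 32 * n ^ 2 * (θ ^ 2 * (m - 2 * (n * θ))) := by
    rw [hθ]; field_simp; ring
  rw [h6]
  gcongr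

/-- Weight the pairs yz by the triangles they form with a vertex a. A three-walk in this weighted
graph, closed up through a, is a closed five-walk at a. The three-walk bound and the power mean
inequality over a give the estimate. -/
theorem sum_triangles_cube_le {R : Matrix V V ℝ} (hR0 : ∀ x y, 0 ≤ R x y)
    (hR1 : ∀ x y, R x y ≤ 1) (hRs : ∀ x y, R x y = R y x) (hn : 0 < Fintype.card V) :
    (∑ x, ∑ y, ∑ z, R x y * R y z * R x z) ^ 3
      ≤ 32 * (Fintype.card V : ℝ) ^ 4 * (R * R * R * R * R).trace := by
  set n : ℝ := (Fintype.card V : ℝ) with hndef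
  have hn0 : 0 < n := by rw [hndef]; exact_mod_cast hn
  have h1 : ∀ a, (∑ y, ∑ z, R a y * R y z * R a z) ^ 3
      ≤ 32 * n ^ 2 * (R * R * R * R * R) a a := by
    intro a
    have hq0 : ∀ y z, 0 ≤ R a y * R y z * R a z := fun y z =>
      mul_nonneg (mul_nonneg (hR0 _ _) (hR0 _ _)) (hR0 _ _)
    have h2 := sum_cube_le_three_walks (fun y z => R a y * R y z * R a z) hq0
      (fun y z => by rw [hRs y z]; ring) hn
    refine h2.trans ?_
    gcongr
    have h3 : ∀ y, ∑ u, R a y * R y u * R a u ≤ (R * R) a y := fun y => by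
      rw [Matrix.mul_apply]
      refine Finset.sum_le_sum fun u _ => ?_
      rw [hRs u y]
      nlinarith [mul_nonneg (hR0 y u) (hR0 a u), hR1 a y]
    have h4 : ∀ y z, R a y * R y z * R a z ≤ R y z := fun y z => by
      calc R a y * R y z * R a z ≤ 1 * R y z * 1 :=
            mul_le_mul (mul_le_mul (hR1 _ _) le_rfl (hR0 _ _) zero_le_one) (hR1 _ _) (hR0 _ _)
              (by simpa using hR0 y z)
        _ = _ := by ring
    have hRR0 := entry_mul_nonneg hR0 hR0
    have hRRs : ∀ x y, (R * R) x y = (R * R) y x := fun x y => by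
      rw [Matrix.mul_apply, Matrix.mul_apply]
      exact Finset.sum_congr rfl fun u _ => by rw [hRs x u, hRs u y, mul_comm]
    calc ∑ y, ∑ z, (∑ u, R a y * R y u * R a u) * (R a y * R y z * R a z)
          * (∑ u, R a z * R z u * R a u)
        ≤ ∑ y, ∑ z, (R * R) a y * R y z * (R * R) z a := by
          refine Finset.sum_le_sum fun y _ => Finset.sum_le_sum fun z _ => ?_
          rw [hRRs z a]
          refine mul_le_mul (mul_le_mul (h3 y) (h4 y z) (hq0 y z) (hRR0 a y)) (h3 z)
            (Finset.sum_nonneg fun _ _ => hq0 _ _) (mul_nonneg (hRR0 a y) (hR0 y z))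
      _ = (R * R * R * R * R) a a := by
          rw [show R * R * R * R * R = (R * R) * R * (R * R) by noncomm_ring,
            Matrix.mul_apply, Finset.sum_comm]
          refine Finset.sum_congr rfl fun z _ => ?_
          rw [Matrix.mul_apply (M := R * R), Finset.sum_mul]
  calc (∑ x, ∑ y, ∑ z, R x y * R y z * R x z) ^ 3
      ≤ n ^ 2 * ∑ x, (∑ y, ∑ z, R x y * R y z * R x z) ^ 3 := by
        have := pow_sum_le_card_mul_sum_pow (s := Finset.univ)
          (f := fun x => ∑ y, ∑ z, R x y * R y z * R x z)
          (fun x _ => Finset.sum_nonneg fun y _ => Finset.sum_nonneg fun z _ =>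
            mul_nonneg (mul_nonneg (hR0 _ _) (hR0 _ _)) (hR0 _ _)) 2
        simpa [hndef] using this
    _ ≤ n ^ 2 * ∑ x, 32 * n ^ 2 * (R * R * R * R * R) x x := by
        gcongr with x _
        exact h1 x
    _ = _ := by
        rw [← Finset.mul_sum, Matrix.trace]
        simp only [Matrix.diag_apply]
        ring

/-- There is no cycle of length five. -/
def SimpleGraph.FiveCycleFree {V : Type*} (G : SimpleGraph V) : Prop :=
  ∀ ⦃x y z u v⦄, G.Adj x y → G.Adj y z → G.Adj z u → G.Adj u v → G.Adj v x →
    x ≠ z → y ≠ u → z ≠ v → u ≠ x → v ≠ y → False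

theorem sum_five_cyclic (F : V → V → V → V → V → ℝ) :
    ∑ x, ∑ y, ∑ z, ∑ u, ∑ v, F y z u v x = ∑ x, ∑ y, ∑ z, ∑ u, ∑ v, F x y z u v := by
  rw [Finset.sum_comm]
  refine Finset.sum_congr rfl fun y _ => ?_
  rw [Finset.sum_comm]
  refine Finset.sum_congr rfl fun z _ => ?_
  rw [Finset.sum_comm]
  refine Finset.sum_congr rfl fun u _ => ?_
  rw [Finset.sum_comm]

/-- In a graph without cycles of lengths four and five, closed walks of length five are rare. -/
theorem trace_five_le {G : SimpleGraph V} (h4 : G.FourCycleFree) (h5 : G.FiveCycleFree)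
    {D : ℝ} (hD0 : 0 ≤ D) (hD : ∀ x, ∑ y, G.ind x y ≤ D) (A : Matrix V V ℝ)
    (hA : ∀ x y, A x y = G.ind x y) :
    (A * A * A * A * A).trace ≤ 5 * (Fintype.card V * (D * D)) := by
  have htr : (A * A * A * A * A).trace = ∑ x, ∑ y, ∑ z, ∑ u, ∑ v,
      G.ind x v * G.ind v u * G.ind u z * G.ind z y * G.ind y x := by
    simp only [Matrix.trace, Matrix.diag_apply, Matrix.mul_apply, Finset.sum_mul, hA]
  let P : V → V → V → V → V → ℝ := fun x y z u v =>
    G.ind x v * G.ind v u * G.ind u z * G.ind z y * G.ind y x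
  have hP0 : ∀ x y z u v, 0 ≤ P x y z u v := fun x y z u v => by
    have := G.ind_nonneg
    exact mul_nonneg (mul_nonneg (mul_nonneg (mul_nonneg (this _ _) (this _ _)) (this _ _))
      (this _ _)) (this _ _)
  have hPc : ∀ x y z u v, P y z u v x = P x y z u v := fun x y z u v => by
    simp only [P]; rw [G.ind_comm y x, G.ind_comm z y, G.ind_comm u z, G.ind_comm v u,
      G.ind_comm x v]; ring
  -- Without five-cycles, a closed five-walk must repeat a vertex at cyclic distance two. F records
  -- one of the five positions, and the others are its rotations.
  let F : V → V → V → V → V → ℝ := fun x y z u v => (if x = z then 1 else 0) * P x y z u v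
  have hF0 : ∀ x y z u v, 0 ≤ F x y z u v := fun x y z u v => by
    refine mul_nonneg ?_ (hP0 _ _ _ _ _)
    split_ifs <;> norm_num
  have hFeq : ∀ x y z u v, x = z → F x y z u v = P x y z u v := fun x y z u v h => by
    simp [F, h]
  have hcover : ∀ x y z u v, P x y z u v ≤ F x y z u v + F y z u v x + F z u v x y
      + F u v x y z + F v x y z u := by
    intro x y z u v
    have f1 := hF0 x y z u v
    have f2 := hF0 y z u v x
    have f3 := hF0 z u v x y
    have f4 := hF0 u v x y z
    have f5 := hF0 v x y z u
    have p2 := hPc x y z u v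
    have p3 := (hPc y z u v x).trans p2
    have p4 := (hPc z u v x y).trans p3
    have p5 := (hPc u v x y z).trans p4
    by_cases e1 : x = z
    · rw [← hFeq x y z u v e1]; linarith
    by_cases e2 : y = u
    · rw [← p2, ← hFeq y z u v x e2]; linarith
    by_cases e3 : z = v
    · rw [← p3, ← hFeq z u v x y e3]; linarith
    by_cases e4 : u = x
    · rw [← p4, ← hFeq u v x y z e4]; linarith
    by_cases e5 : v = y
    · rw [← p5, ← hFeq v x y z u e5]; linarith
    have : P x y z u v = 0 := by
      by_contra hne
      have h0 : ∀ a b, G.ind a b ≠ 0 → G.Adj a b := fun a b h => by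
        by_contra hab
        exact h (by simp [SimpleGraph.ind, hab])
      simp only [P, mul_ne_zero_iff] at hne
      obtain ⟨⟨⟨⟨a1, a2⟩, a3⟩, a4⟩, a5⟩ := hne
      exact h5 (h0 _ _ a5).symm (h0 _ _ a4).symm (h0 _ _ a3).symm (h0 _ _ a2).symm
        (h0 _ _ a1).symm e1 e2 e3 e4 e5
    linarith
  -- When x = z the walk is an edge traversed back and forth plus a triangle x u v: at most D
  -- choices of y, D of u, and one common neighbour v.
  have hFsum : ∑ x, ∑ y, ∑ z, ∑ u, ∑ v, F x y z u v ≤ Fintype.card V * (D * D) := by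
    have h1 : ∀ x y, ∑ z, ∑ u, ∑ v, F x y z u v
        = G.ind x y * ∑ u, G.ind u x * ∑ v, G.ind x v * G.ind u v := by
      intro x y
      simp only [F, ← Finset.mul_sum]
      simp only [ite_mul, one_mul, zero_mul, Finset.sum_ite_eq, Finset.mem_univ, if_true, P]
      rw [Finset.mul_sum]
      refine Finset.sum_congr rfl fun u _ => ?_
      simp_rw [Finset.mul_sum]
      refine Finset.sum_congr rfl fun v _ => ?_
      rw [G.ind_comm v u, G.ind_comm y x]
      linear_combination (G.ind x v * G.ind u v * G.ind u x) * G.ind_mul_self x y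
    have h2 : ∀ x, ∑ u, G.ind u x * ∑ v, G.ind x v * G.ind u v ≤ D := by
      intro x
      refine le_trans (Finset.sum_le_sum fun u _ => ?_) (hD x)
      rw [G.ind_comm u x]
      by_cases h : x = u
      · subst h; simp [G.ind_self]
      · exact mul_le_of_le_one_right (G.ind_nonneg _ _) (h4.sum_ind_mul_ind_le_one h)
    calc ∑ x, ∑ y, ∑ z, ∑ u, ∑ v, F x y z u v
        ≤ ∑ x, ∑ y, G.ind x y * D := by
          refine Finset.sum_le_sum fun x _ => Finset.sum_le_sum fun y _ => ?_
          rw [h1]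
          exact mul_le_mul_of_nonneg_left (h2 x) (G.ind_nonneg _ _)
      _ ≤ ∑ _x : V, D * D := by
          refine Finset.sum_le_sum fun x _ => ?_
          rw [← Finset.sum_mul]
          gcongr
          exact hD x
      _ = _ := by simp
  have c1 := sum_five_cyclic F
  have c2 := sum_five_cyclic fun x y z u v => F y z u v x
  have c3 := sum_five_cyclic fun x y z u v => F z u v x y
  have c4 := sum_five_cyclic fun x y z u v => F u v x y z
  rw [htr]
  calc ∑ x, ∑ y, ∑ z, ∑ u, ∑ v, P x y z u v
      ≤ ∑ x, ∑ y, ∑ z, ∑ u, ∑ v, (F x y z u v + F y z u v x + F z u v x y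
      + F u v x y z + F v x y z u) :=
        Finset.sum_le_sum fun x _ => Finset.sum_le_sum fun y _ => Finset.sum_le_sum fun z _ =>
          Finset.sum_le_sum fun u _ => Finset.sum_le_sum fun v _ => hcover x y z u v
    _ ≤ _ := by
      simp only [Finset.sum_add_distrib]
      linarith

end FiveWalkBounds

/-! ### Triangle removal compatible with a colouring. -/

section ColorRemoval

open scoped Classical

variable {V : Type*} [Fintype V]

/-- Three copies of a symmetric relation, arranged as a tripartite graph. -/
def tripartiteGraph (r : V → V → Prop) (hr : ∀ x y, r x y → r y x) : SimpleGraph (V × Fin 3) where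
  Adj p q := p.2 ≠ q.2 ∧ r p.1 q.1
  symm := ⟨fun _ _ h => ⟨h.1.symm, hr _ _ h.2⟩⟩
  loopless := ⟨fun _ h => h.1 rfl⟩

/-- A triangle is an ordered triple of related vertices with an assignment of parts, and there are
3³ = 27 assignments. -/
theorem card_cliqueFinset_tripartiteGraph_le (r : V → V → Prop) (hr : ∀ x y, r x y → r y x) :
    ((tripartiteGraph r hr).cliqueFinset 3).card
      ≤ 27 * (Finset.univ.filter fun p : V × V × V =>
        r p.1 p.2.1 ∧ r p.2.1 p.2.2 ∧ r p.1 p.2.2).card := by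
  set T := Finset.univ.filter fun p : V × V × V => r p.1 p.2.1 ∧ r p.2.1 p.2.2 ∧ r p.1 p.2.2
  have hsub : (tripartiteGraph r hr).cliqueFinset 3 ⊆
      (T ×ˢ (Finset.univ : Finset (Fin 3 × Fin 3 × Fin 3))).image
        fun p => {(p.1.1, p.2.1), (p.1.2.1, p.2.2.1), (p.1.2.2, p.2.2.2)} := by
    intro t ht
    rw [SimpleGraph.mem_cliqueFinset_iff, SimpleGraph.is3Clique_iff] at ht
    obtain ⟨a, b, d, hab, had, hbd, rfl⟩ := ht
    refine Finset.mem_image.2 ⟨((a.1, b.1, d.1), (a.2, b.2, d.2)), ?_, rfl⟩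
    simp only [T, Finset.mem_product, Finset.mem_filter, Finset.mem_univ, true_and, and_true]
    exact ⟨hab.2, hbd.2, had.2⟩
  refine (Finset.card_le_card hsub).trans (Finset.card_image_le.trans ?_)
  rw [Finset.card_product, Finset.card_univ, mul_comm]
  simp

/-- First moment: choosing x, y, z independently with laws α, β, γ, the hypothesis bounds the
expectation of the sum of the three values of D. -/
theorem exists_of_weighted_sum_lt_one {α β γ : V → ℝ} (hα : ∀ x, 0 ≤ α x) (hβ : ∀ x, 0 ≤ β x)
    (hγ : ∀ x, 0 ≤ γ x) (hα1 : ∑ x, α x = 1) (hβ1 : ∑ x, β x = 1) (hγ1 : ∑ x, γ x = 1)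
    (D : V → V → ℝ)
    (h : ∑ y, β y * ∑ x, α x * D x y + ∑ z, γ z * ∑ y, β y * D y z
      + ∑ z, γ z * ∑ x, α x * D x z < 1) :
    ∃ x y z, α x ≠ 0 ∧ β y ≠ 0 ∧ γ z ≠ 0 ∧ D x y + D y z + D x z < 1 := by
  by_contra! hcon
  have h1 : ∀ x y z, α x * β y * γ z * 1 ≤ α x * β y * γ z * (D x y + D y z + D x z) := by
    intro x y z
    by_cases hx : α x = 0
    · simp [hx]
    by_cases hy : β y = 0
    · simp [hy]
    by_cases hz : γ z = 0
    · simp [hz]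
    exact mul_le_mul_of_nonneg_left (hcon x y z hx hy hz)
      (mul_nonneg (mul_nonneg (hα _) (hβ _)) (hγ _))
  have h2 : ∑ x, ∑ y, ∑ z, α x * β y * γ z * 1 = 1 := by
    simp_rw [mul_one, ← Finset.mul_sum, hγ1, mul_one, ← Finset.mul_sum, hβ1, mul_one, hα1]
  have h3 : ∑ x, ∑ y, ∑ z, α x * β y * γ z * (D x y + D y z + D x z)
      = ∑ y, β y * ∑ x, α x * D x y + ∑ z, γ z * ∑ y, β y * D y z
      + ∑ z, γ z * ∑ x, α x * D x z := by
    simp_rw [mul_add, Finset.sum_add_distrib]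
    congr 1
    · congr 1
      · rw [Finset.sum_comm]
        simp_rw [Finset.mul_sum]
        refine Finset.sum_congr rfl fun y _ => Finset.sum_congr rfl fun x _ => ?_
        calc ∑ z, α x * β y * γ z * D x y = ∑ z, γ z * (α x * β y * D x y) :=
              Finset.sum_congr rfl fun z _ => by ring
          _ = β y * (α x * D x y) := by rw [← Finset.sum_mul, hγ1]; ring
      · calc ∑ x, ∑ y, ∑ z, α x * β y * γ z * D y z
            = ∑ x, α x * ∑ y, ∑ z, β y * γ z * D y z := by
              simp_rw [Finset.mul_sum, mul_assoc]
          _ = ∑ y, ∑ z, β y * γ z * D y z := by rw [← Finset.sum_mul, hα1, one_mul]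
          _ = _ := by
              rw [Finset.sum_comm]
              simp_rw [Finset.mul_sum]
              exact Finset.sum_congr rfl fun z _ => Finset.sum_congr rfl fun y _ => by ring
    · calc ∑ x, ∑ y, ∑ z, α x * β y * γ z * D x z
          = ∑ x, ∑ y, β y * ∑ z, α x * γ z * D x z := by
            simp_rw [Finset.mul_sum]
            refine Finset.sum_congr rfl fun x _ => Finset.sum_congr rfl fun y _ =>
              Finset.sum_congr rfl fun z _ => by ring
        _ = ∑ x, ∑ z, α x * γ z * D x z := by simp_rw [← Finset.sum_mul, hβ1, one_mul]
        _ = _ := by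
            rw [Finset.sum_comm]
            simp_rw [Finset.mul_sum]
            exact Finset.sum_congr rfl fun z _ => Finset.sum_congr rfl fun x _ => by ring
  rw [← h3, ← h2] at h
  exact absurd h (not_lt.2 (Finset.sum_le_sum fun x _ => Finset.sum_le_sum fun y _ =>
    Finset.sum_le_sum fun z _ => h1 x y z))

/-- Triangle removal for a relation that depends only on colours: the pairs to be removed can be
chosen to depend only on colours, too. -/
theorem exists_colored_removal {ι : Type*} (c : V → ι) (r : V → V → Prop)
    (hr : ∀ x y, r x y → r y x)
    (hrc : ∀ x x' y y', c x = c x' → c y = c y' → r x y → r x' y') {ε : ℝ}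
    (hT : ((Finset.univ.filter fun p : V × V × V =>
        r p.1 p.2.1 ∧ r p.2.1 p.2.2 ∧ r p.1 p.2.2).card : ℝ)
      < SimpleGraph.triangleRemovalBound ε * Fintype.card V ^ 3) :
    ∃ bad : V → V → Prop, (∀ x x' y y', c x = c x' → c y = c y' → (bad x y ↔ bad x' y')) ∧
      ∑ x, ∑ y, (if bad x y then (1 : ℝ) else 0) ≤ 81 * ε * Fintype.card V ^ 2 ∧
      ∀ x y z, r x y → r y z → r x z → bad x y ∨ bad y z ∨ bad x z := by
  set H := tripartiteGraph r hr with hH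
  have hcard := card_cliqueFinset_tripartiteGraph_le r hr
  -- On 3|V| vertices the threshold is scaled by 27, which matches the clique bound.
  obtain ⟨H', hle, hdec, hdel, hfree⟩ := SimpleGraph.triangle_removal (G := H) (ε := ε) (by
    have h1 : ((H.cliqueFinset 3).card : ℝ) ≤ 27 * ((Finset.univ.filter fun p : V × V × V =>
        r p.1 p.2.1 ∧ r p.2.1 p.2.2 ∧ r p.1 p.2.2).card : ℝ) := by
      rw [hH]; exact_mod_cast hcard
    rw [Fintype.card_prod, Fintype.card_fin]
    push_cast
    nlinarith)
  let del : Fin 3 → Fin 3 → V → V → ℝ := fun s t x y =>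
    if H.Adj (x, s) (y, t) ∧ ¬ H'.Adj (x, s) (y, t) then 1 else 0
  have hdel0 : ∀ s t x y, 0 ≤ del s t x y := fun s t x y => by
    simp only [del]; split_ifs <;> norm_num
  have hdelsum : ∀ s t, s ≠ t → ∑ x, ∑ y, del s t x y ≤ 9 * ε * Fintype.card V ^ 2 := by
    intro s t hst
    have h1 : ∑ x, ∑ y, del s t x y = ((Finset.univ.filter fun p : V × V =>
        H.Adj (p.1, s) (p.2, t) ∧ ¬ H'.Adj (p.1, s) (p.2, t)).card : ℝ) := by
      rw [← Fintype.sum_prod_type', Finset.card_filter]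
      push_cast
      rfl
    have h2 : (Finset.univ.filter fun p : V × V =>
        H.Adj (p.1, s) (p.2, t) ∧ ¬ H'.Adj (p.1, s) (p.2, t)).card
        ≤ (H.edgeFinset \ H'.edgeFinset).card := by
      refine Finset.card_le_card_of_injOn (fun p => s((p.1, s), (p.2, t))) ?_ ?_
      · intro p hp
        simpa using hp
      · rintro ⟨x, y⟩ - ⟨x', y'⟩ - h
        simp only [Sym2.eq_iff, Prod.mk.injEq] at h
        rcases h with h | h
        · exact Prod.ext h.1.1 h.2.1
        · exact absurd h.1.2 hst
    have hsub : H'.edgeFinset ⊆ H.edgeFinset := SimpleGraph.edgeFinset_mono hle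
    rw [Finset.card_sdiff_of_subset hsub] at h2
    rw [h1]
    refine (show _ ≤ ((H.edgeFinset.card - H'.edgeFinset.card : ℕ) : ℝ) by
      exact_mod_cast h2).trans ?_
    rw [Nat.cast_sub (Finset.card_le_card hsub)]
    refine hdel.le.trans (le_of_eq ?_)
    rw [Fintype.card_prod, Fintype.card_fin]
    push_cast
    ring
  let D : V → V → ℝ := fun x y => del 0 1 x y + del 1 2 x y + del 0 2 x y
  have hD0 : ∀ x y, 0 ≤ D x y := fun x y =>
    add_nonneg (add_nonneg (hdel0 _ _ _ _) (hdel0 _ _ _ _)) (hdel0 _ _ _ _)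
  have hDsum : ∑ x, ∑ y, D x y ≤ 27 * ε * Fintype.card V ^ 2 := by
    simp only [D, Finset.sum_add_distrib]
    linarith [hdelsum 0 1 (by decide), hdelsum 1 2 (by decide), hdelsum 0 2 (by decide)]
  -- By Markov, requiring a class average of at least 1/3 costs a factor 3, hence 81 = 3 · 27. If no
  -- pair of a related triangle is bad, its three averages sum to less than 1, so some triple of the
  -- same colours has all three edges undeleted, which is impossible in a triangle-free graph.
  refine ⟨fun x y => 1 / 3 ≤ colorAvg c D x y, fun x x' y y' hx hy => ?_, ?_, ?_⟩
  · simp only [colorAvg_congr c D hx hy]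
  · have h1 := sum_colorAvg_mul c D (fun _ _ => 1) fun _ _ _ _ _ _ => rfl
    simp only [mul_one] at h1
    calc ∑ x, ∑ y, (if 1 / 3 ≤ colorAvg c D x y then (1 : ℝ) else 0)
        ≤ ∑ x, ∑ y, 3 * colorAvg c D x y := by
          refine Finset.sum_le_sum fun x _ => Finset.sum_le_sum fun y _ => ?_
          have := colorAvg_nonneg c D hD0 x y
          split_ifs <;> linarith
      _ = 3 * ∑ x, ∑ y, D x y := by rw [← h1]; simp_rw [Finset.mul_sum]
      _ ≤ _ := by linarith
  · intro x y z hxy hyz hxz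
    by_contra! hcon
    obtain ⟨h1, h2, h3⟩ := hcon
    obtain ⟨x', y', z', hx, hy, hz, hlt⟩ := exists_of_weighted_sum_lt_one
      (avgKernel_nonneg c x) (avgKernel_nonneg c y) (avgKernel_nonneg c z)
      (sum_avgKernel c x) (sum_avgKernel c y) (sum_avgKernel c z) D (by
        unfold colorAvg at h1 h2 h3; linarith)
    have hc : ∀ u u', avgKernel c u u' ≠ 0 → c u = c u' := fun u u' h => by
      by_contra hne
      exact h (by simp [avgKernel, hne])
    have hxy' := hrc _ _ _ _ (hc _ _ hx) (hc _ _ hy) hxy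
    have hyz' := hrc _ _ _ _ (hc _ _ hy) (hc _ _ hz) hyz
    have hxz' := hrc _ _ _ _ (hc _ _ hx) (hc _ _ hz) hxz
    have hkeep : ∀ (s t : Fin 3) (u v : V), s ≠ t → r u v → del s t u v < 1 →
        H'.Adj (u, s) (v, t) := by
      intro s t u v hst huv hlt
      by_contra hnot
      have : del s t u v = 1 := if_pos ⟨⟨hst, huv⟩, hnot⟩
      linarith
    have a1 := hkeep 0 1 x' y' (by decide) hxy' (by
      linarith [hdel0 1 2 x' y', hdel0 0 2 x' y', hD0 y' z', hD0 x' z',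
        show D x' y' = del 0 1 x' y' + del 1 2 x' y' + del 0 2 x' y' from rfl])
    have a2 := hkeep 1 2 y' z' (by decide) hyz' (by
      linarith [hdel0 0 1 y' z', hdel0 0 2 y' z', hD0 x' y', hD0 x' z',
        show D y' z' = del 0 1 y' z' + del 1 2 y' z' + del 0 2 y' z' from rfl])
    have a3 := hkeep 0 2 x' z' (by decide) hxz' (by
      linarith [hdel0 0 1 x' z', hdel0 1 2 x' z', hD0 x' y', hD0 y' z',
        show D x' z' = del 0 1 x' z' + del 1 2 x' z' + del 0 2 x' z' from rfl])
    exact hfree _ (SimpleGraph.is3Clique_triple_iff.2 ⟨a1, a3, a2⟩)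

end ColorRemoval

/-! ### Graphs without C4 and C5 have few triangles. -/

section TriangleCount

open scoped Classical

variable {V : Type*} [Fintype V]

/-- The number of labelled triangles. -/
noncomputable def SimpleGraph.triangleSum (G : SimpleGraph V) : ℝ :=
  ∑ x, ∑ y, ∑ z, G.ind x y * G.ind y z * G.ind x z

/-- The ends of an edge have at most one common neighbour, so each edge is charged by at most one
triangle in each of the three positions. -/
theorem SimpleGraph.FourCycleFree.sum_triangles_mul_le {G : SimpleGraph V}
    (hG : G.FourCycleFree) (h : V → V → ℝ) (hh : ∀ x y, 0 ≤ h x y) :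
    ∑ x, ∑ y, ∑ z, G.ind x y * G.ind y z * G.ind x z * (h x y + h y z + h x z)
      ≤ 3 * ∑ x, ∑ y, G.ind x y * h x y := by
  have key : ∑ x, ∑ y, ∑ z, G.ind x y * G.ind y z * G.ind x z * h x y
      ≤ ∑ x, ∑ y, G.ind x y * h x y := by
    refine Finset.sum_le_sum fun x _ => Finset.sum_le_sum fun y _ => ?_
    have h1 : ∑ z, G.ind x y * G.ind y z * G.ind x z * h x y
        = G.ind x y * h x y * ∑ z, G.ind x z * G.ind y z := by
      rw [Finset.mul_sum]
      exact Finset.sum_congr rfl fun z _ => by ring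
    rw [h1]
    by_cases hxy : x = y
    · subst hxy; simp [G.ind_self]
    · exact mul_le_of_le_one_right (mul_nonneg (G.ind_nonneg _ _) (hh _ _))
        (hG.sum_ind_mul_ind_le_one hxy)
  have e2 : ∑ x, ∑ y, ∑ z, G.ind x y * G.ind y z * G.ind x z * h y z
      = ∑ x, ∑ y, ∑ z, G.ind x y * G.ind y z * G.ind x z * h x y := by
    rw [Finset.sum_comm]
    refine Finset.sum_congr rfl fun y _ => ?_
    rw [Finset.sum_comm]
    refine Finset.sum_congr rfl fun z _ => Finset.sum_congr rfl fun x _ => ?_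
    rw [G.ind_comm x y, G.ind_comm x z]; ring
  have e3 : ∑ x, ∑ y, ∑ z, G.ind x y * G.ind y z * G.ind x z * h x z
      = ∑ x, ∑ y, ∑ z, G.ind x y * G.ind y z * G.ind x z * h x y := by
    refine Finset.sum_congr rfl fun x _ => ?_
    rw [Finset.sum_comm]
    refine Finset.sum_congr rfl fun z _ => Finset.sum_congr rfl fun y _ => ?_
    rw [G.ind_comm y z]; ring
  simp_rw [mul_add, Finset.sum_add_distrib]
  rw [e2, e3]
  linarith

/-- A graph without cycles of lengths four and five is regular relative to a colouring whose
reduced relation contains few triangles. -/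
theorem card_triangles_reduced_lt {G : SimpleGraph V} (h4 : G.FourCycleFree)
    (h5 : G.FiveCycleFree) {ρ η ε δ s : ℝ} (hs : 0 < s) (hsn : s * s = Fintype.card V)
    (hD : ∀ x, ∑ y, G.ind x y ≤ 2 * s) (hε : 0 < ε) (hδ : 0 < δ) (hρ : ρ = ε / s)
    (hη : η * (ε ^ 4 + 2 * ε ^ 3 + ε ^ 2 + 2 * ε + 1) = ε ^ 5 * (δ ^ 3 / 32) / 2)
    (hlarge : 20 + 2 * ε ^ 3 + 2 * ε < s * (ε ^ 5 * (δ ^ 3 / 32) / 2))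
    (r : V → V → Prop) (hr : ∀ x y, r x y → r y x)
    (hcut : ∀ f g : V → ℝ, (∀ x, 0 ≤ f x) → (∀ x, f x ≤ 1) → (∀ x, 0 ≤ g x) → (∀ x, g x ≤ 1) →
      ρ * (∑ x, ∑ y, f x * (if r x y then 1 else 0) * g y) - η * (Fintype.card V * s)
        ≤ ∑ x, ∑ y, f x * G.ind x y * g y) :
    ((Finset.univ.filter fun p : V × V × V =>
        r p.1 p.2.1 ∧ r p.2.1 p.2.2 ∧ r p.1 p.2.2).card : ℝ) < δ * Fintype.card V ^ 3 := by
  by_contra! hcon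
  have hnpos : (0 : ℝ) < Fintype.card V := by rw [← hsn]; positivity
  have hn : 0 < Fintype.card V := by exact_mod_cast hnpos
  let A : Matrix V V ℝ := fun x y => G.ind x y
  let R : Matrix V V ℝ := fun x y => if r x y then 1 else 0
  have hR0 : ∀ x y, 0 ≤ R x y := fun x y => by simp only [R]; split_ifs <;> norm_num
  have hR1 : ∀ x y, R x y ≤ 1 := fun x y => by simp only [R]; split_ifs <;> norm_num
  have hRs : ∀ x y, R x y = R y x := fun x y => by
    simp only [R]; exact if_congr ⟨hr _ _, hr _ _⟩ rfl rfl
  have hAA : ∀ x y, (A * A) x y = ∑ u, G.ind x u * G.ind y u := fun x y => by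
    rw [Matrix.mul_apply]
    exact Finset.sum_congr rfl fun u _ => by simp only [A]; rw [G.ind_comm u y]
  have hlow := trace_pow_five_ge (A := A) (R := R) (ρ := ρ) (t := η * (Fintype.card V * s))
    (D := 2 * s) (by rw [hρ]; positivity) (by positivity) hn hcut (fun x y => G.ind_nonneg x y)
    (fun x y hxy => by rw [hAA]; exact h4.sum_ind_mul_ind_le_one hxy)
    (fun x => by rw [hAA]; simp_rw [G.ind_mul_self]; exact hD x) hD hR0 hR1
  have hup := trace_five_le h4 h5 (by positivity) hD A fun _ _ => rfl
  have htri := sum_triangles_cube_le hR0 hR1 hRs hn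
  have hcount : ∑ x, ∑ y, ∑ z, R x y * R y z * R x z
      = ((Finset.univ.filter fun p : V × V × V =>
        r p.1 p.2.1 ∧ r p.2.1 p.2.2 ∧ r p.1 p.2.2).card : ℝ) := by
    rw [Finset.card_filter]
    push_cast
    rw [Fintype.sum_prod_type]
    refine Finset.sum_congr rfl fun x _ => ?_
    rw [Fintype.sum_prod_type]
    refine Finset.sum_congr rfl fun y _ => Finset.sum_congr rfl fun z _ => ?_
    simp only [R]
    by_cases h1 : r x y <;> by_cases h2 : r y z <;> by_cases h3 : r x z <;> simp [h1, h2, h3]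
  rw [hcount] at htri
  set n : ℝ := (Fintype.card V : ℝ)
  have htr5 : δ ^ 3 / 32 * n ^ 5 ≤ (R * R * R * R * R).trace := by
    have h1 : (δ * n ^ 3) ^ 3 ≤ 32 * n ^ 4 * (R * R * R * R * R).trace :=
      (pow_le_pow_left₀ (by positivity) hcon 3).trans htri
    have h2 : (δ * n ^ 3) ^ 3 = 32 * n ^ 4 * (δ ^ 3 / 32 * n ^ 5) := by ring
    rw [h2] at h1
    exact le_of_mul_le_mul_left h1 (by positivity)
  have hρ0 : 0 ≤ ρ := by rw [hρ]; positivity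
  have h1 := mul_le_mul_of_nonneg_left htr5 (pow_nonneg hρ0 5)
  have h2 := (sub_le_sub_right h1 _).trans (hlow.trans hup)
  -- With ρ = ε/s and n = s², the main term and the cut-norm errors are of order n²s, while the
  -- diagonal terms and the upper bound are of order n². `hη` keeps half of the main term and
  -- `hlarge` beats the n² terms.
  have h3 : ρ ^ 5 * (δ ^ 3 / 32 * n ^ 5) - (ρ ^ 4 * (n ^ 3 * (η * (n * s)))
      + ρ ^ 3 * (n ^ 2 * (2 * s) * (η * (n * s))) + ρ ^ 3 * (n ^ 3 * (2 * s))
      + ρ ^ 2 * (n ^ 2 * (η * (n * s))) + ρ * (n * (2 * s) * (η * (n * s)))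
      + ρ * (n ^ 2 * (2 * s)) + n * (η * (n * s))) - 5 * (n * (2 * s * (2 * s)))
      = n ^ 2 * (s * (ε ^ 5 * (δ ^ 3 / 32)
        - η * (ε ^ 4 + 2 * ε ^ 3 + ε ^ 2 + 2 * ε + 1)) - (20 + 2 * ε ^ 3 + 2 * ε)) := by
    rw [hρ, ← hsn]; field_simp; ring
  have h4 : 0 < n ^ 2 * (s * (ε ^ 5 * (δ ^ 3 / 32)
        - η * (ε ^ 4 + 2 * ε ^ 3 + ε ^ 2 + 2 * ε + 1)) - (20 + 2 * ε ^ 3 + 2 * ε)) := by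
    refine mul_pos (by positivity) ?_
    rw [hη]
    linarith
  linarith

/-- Every triangle has a pair of low class density or a pair discarded by removal. The first kind
carries at most ρn² of edge mass; the second is bounded by Cauchy–Schwarz against the energy. -/
theorem triangleSum_le_of_degree_le {ε : ℝ} (hε : 0 < ε) :
    ∃ s₀ : ℝ, ∀ (V : Type) [Fintype V] (G : SimpleGraph V) (s : ℝ), s₀ ≤ s →
      s * s = Fintype.card V → G.FourCycleFree → G.FiveCycleFree →
      (∀ x, ∑ y, G.ind x y ≤ 2 * s) → G.triangleSum ≤ ε * (Fintype.card V * s) := by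
  set ε₁ : ℝ := ε / 6 with hε₁
  have hε₁0 : 0 < ε₁ := by positivity
  -- Chosen so that 2n · 81 ε₂ n² = (ε n s / 6)².
  set ε₂ : ℝ := ε ^ 2 / 5832 with hε₂
  have hε₂0 : 0 < ε₂ := by positivity
  set δ : ℝ := SimpleGraph.triangleRemovalBound ε₂
  have hδ : 0 < δ := SimpleGraph.triangleRemovalBound_pos hε₂0
  set P : ℝ := ε₁ ^ 4 + 2 * ε₁ ^ 3 + ε₁ ^ 2 + 2 * ε₁ + 1 with hP
  have hP0 : 0 < P := by positivity
  set K : ℝ := ε₁ ^ 5 * (δ ^ 3 / 32) / 2 with hK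
  have hK0 : 0 < K := by positivity
  set η : ℝ := K / P with hη
  have hη0 : 0 < η := by positivity
  -- After J increments the energy would be at least 3n, above the bound 2n.
  set J : ℕ := ⌈3 / η ^ 2⌉₊ with hJ
  have hJη : 3 ≤ J * η ^ 2 := by
    have := Nat.le_ceil (3 / η ^ 2)
    rwa [div_le_iff₀ (by positivity)] at this
  -- For s ≥ 2 · 4^J, the colour term 2s · 4^J of the energy bound is at most s² = n.
  refine ⟨max (2 * 4 ^ J) ((20 + 2 * ε₁ ^ 3 + 2 * ε₁) / K + 1),
    fun V _ G s hs hsn h4 h5 hD => ?_⟩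
  have hs1 : 2 * 4 ^ J ≤ s := (le_max_left _ _).trans hs
  have hs2 : (20 + 2 * ε₁ ^ 3 + 2 * ε₁) / K + 1 ≤ s := (le_max_right _ _).trans hs
  have hs0 : 0 < s := lt_of_lt_of_le (by positivity) hs1
  have hlarge : 20 + 2 * ε₁ ^ 3 + 2 * ε₁ < s * K := by
    rw [← div_lt_iff₀ hK0]; linarith
  set n : ℝ := (Fintype.card V : ℝ) with hn
  have hn0 : 0 < n := by rw [← hsn]; positivity
  set t : ℝ := η * (n * s) with ht
  have ht0 : 0 < t := by positivity
  obtain ⟨ι, _, c, hι, hreg⟩ := exists_regular_or_energy (V := V) G.ind ht0.le J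
  have hE : colorEnergy c G.ind ≤ 2 * n := by
    refine (colorEnergy_le c G.ind (D := 2 * s)
      (fun x y hxy => h4.sum_ind_mul_ind_le_one hxy)
      (fun x => by simp_rw [G.ind_mul_self]; exact hD x) (by positivity)).trans ?_
    have hιR : (Fintype.card ι : ℝ) ≤ 4 ^ J := by exact_mod_cast hι
    have : 2 * s * Fintype.card ι ≤ s * s := by nlinarith
    linarith
  have hcut := hreg.resolve_right fun h => by
    rw [← hn] at h
    have h1 : n ^ 2 * colorEnergy c G.ind ≤ n ^ 2 * (2 * n) := by gcongr
    have h2 : J * t ^ 2 = J * η ^ 2 * (n ^ 2 * n) := by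
      rw [ht, ← hsn]; ring
    have h3 : 3 * (n ^ 2 * n) ≤ J * η ^ 2 * (n ^ 2 * n) := by gcongr
    have h4 : 0 < n ^ 2 * n := by positivity
    linarith
  set ρ : ℝ := ε₁ / s with hρ
  have hρ0 : 0 < ρ := by positivity
  let W := colorAvg c G.ind
  have hW0 : ∀ x y, 0 ≤ W x y := colorAvg_nonneg c G.ind G.ind_nonneg
  let r : V → V → Prop := fun x y => ρ ≤ W x y
  have hr : ∀ x y, r x y → r y x := fun x y h => by
    simp only [r, W] at h ⊢; rwa [colorAvg_comm c G.ind G.ind_comm]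
  have hrc : ∀ x x' y y', c x = c x' → c y = c y' → r x y → r x' y' :=
    fun x x' y y' hx hy h => by
      simp only [r, W] at h ⊢; rwa [← colorAvg_congr c G.ind hx hy]
  have hfew := card_triangles_reduced_lt (η := η) h4 h5 hs0 hsn hD hε₁0 hδ hρ
    (by rw [hη, ← hP, ← hK]; field_simp) hlarge r hr fun f g hf0 hf1 hg0 hg1 => by
      have h1 := sum_sum_mul_le_of_cut hcut f g hf0 hf1 hg0 hg1
      have h2 : ρ * (∑ x, ∑ y, f x * (if r x y then 1 else 0) * g y)
          ≤ ∑ x, ∑ y, f x * W x y * g y := by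
        simp_rw [Finset.mul_sum]
        refine Finset.sum_le_sum fun x _ => Finset.sum_le_sum fun y _ => ?_
        have h3 : ρ * (if r x y then 1 else 0) ≤ W x y := by
          split_ifs with h
          · simpa using h
          · simpa using hW0 x y
        calc ρ * (f x * (if r x y then 1 else 0) * g y)
            = f x * (ρ * (if r x y then 1 else 0)) * g y := by ring
          _ ≤ _ := mul_le_mul_of_nonneg_right (mul_le_mul_of_nonneg_left h3 (hf0 x)) (hg0 y)
      have h4 : ∑ x, ∑ y, f x * (W x y - G.ind x y) * g y
          = ∑ x, ∑ y, f x * W x y * g y - ∑ x, ∑ y, f x * G.ind x y * g y := by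
        simp_rw [← Finset.sum_sub_distrib]
        exact Finset.sum_congr rfl fun x _ => Finset.sum_congr rfl fun y _ => by ring
      rw [h4] at h1
      linarith
  obtain ⟨bad, hbadc, hbadn, hbad⟩ := exists_colored_removal c r hr hrc hfew
  rw [← hn] at hbadn
  let b₁ : V → V → ℝ := fun x y => if r x y then 0 else 1
  let b₂ : V → V → ℝ := fun x y => if bad x y then 1 else 0
  have hb₁ : ∀ x y, 0 ≤ b₁ x y := fun x y => by simp only [b₁]; split_ifs <;> norm_num
  have hb₂ : ∀ x y, 0 ≤ b₂ x y := fun x y => by simp only [b₂]; split_ifs <;> norm_num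
  let B : V → V → ℝ := fun x y => b₁ x y + b₂ x y
  have hB0 : ∀ x y, 0 ≤ B x y := fun x y => add_nonneg (hb₁ x y) (hb₂ x y)
  have hBc : ∀ x x' y y', c x = c x' → c y = c y' → B x y = B x' y' :=
    fun x x' y y' hx hy => by
      have h1 : r x y ↔ r x' y' := ⟨hrc _ _ _ _ hx hy, hrc _ _ _ _ hx.symm hy.symm⟩
      simp only [B, b₁, b₂, h1, hbadc x x' y y' hx hy]
  have hcover : ∀ x y z, 1 ≤ B x y + B y z + B x z := by
    intro x y z
    have key : ∀ x y, (¬ r x y ∨ bad x y) → 1 ≤ B x y := fun x y h => by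
      simp only [B, b₁, b₂]
      rcases h with h | h
      · rw [if_neg h]; linarith [hb₂ x y]
      · have := hb₁ x y
        simp only [b₁] at this
        rw [if_pos h]; linarith
    have g1 := hB0 x y
    have g2 := hB0 y z
    have g3 := hB0 x z
    by_cases h1 : ¬ r x y ∨ bad x y
    · linarith [key _ _ h1]
    by_cases h2 : ¬ r y z ∨ bad y z
    · linarith [key _ _ h2]
    by_cases h3 : ¬ r x z ∨ bad x z
    · linarith [key _ _ h3]
    push Not at h1 h2 h3
    rcases hbad x y z h1.1 h2.1 h3.1 with h | h | h
    · exact absurd h h1.2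
    · exact absurd h h2.2
    · exact absurd h h3.2
  have hsumB : ∑ x, ∑ y, G.ind x y * B x y ≤ ε / 3 * (n * s) := by
    rw [← sum_colorAvg_mul c G.ind B hBc]
    have h1 : ∑ x, ∑ y, W x y * b₁ x y ≤ ε / 6 * (n * s) := by
      calc ∑ x, ∑ y, W x y * b₁ x y ≤ ∑ _x : V, ∑ _y : V, ρ := by
            refine Finset.sum_le_sum fun x _ => Finset.sum_le_sum fun y _ => ?_
            simp only [b₁]
            split_ifs with h
            · simpa using hρ0.le
            · rw [mul_one]; exact (not_le.1 h).le
        _ = n * (n * ρ) := by simp [hn]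
        _ = _ := by rw [hρ, hε₁, ← hsn]; field_simp
    have h2 : ∑ x, ∑ y, W x y * b₂ x y ≤ ε / 6 * (n * s) := by
      refine abs_le_of_sq_le_sq' (b := ε / 6 * (n * s)) ?_ (by positivity) |>.2
      calc (∑ x, ∑ y, W x y * b₂ x y) ^ 2
          ≤ (∑ x, ∑ y, W x y ^ 2) * (∑ x, ∑ y, b₂ x y ^ 2) := by
            simp_rw [← Fintype.sum_prod_type' (f := fun x y => W x y * b₂ x y),
              ← Fintype.sum_prod_type' (f := fun x y => W x y ^ 2),
              ← Fintype.sum_prod_type' (f := fun x y => b₂ x y ^ 2)]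
            exact Finset.sum_mul_sq_le_sq_mul_sq _ _ _
        _ ≤ 2 * n * (81 * ε₂ * n ^ 2) := by
            refine mul_le_mul hE ?_ (Finset.sum_nonneg fun _ _ => Finset.sum_nonneg
              fun _ _ => sq_nonneg _) (by positivity)
            refine le_trans (le_of_eq ?_) hbadn
            refine Finset.sum_congr rfl fun x _ => Finset.sum_congr rfl fun y _ => ?_
            simp only [b₂]
            split_ifs <;> norm_num
        _ = (ε / 6 * (n * s)) ^ 2 := by rw [hε₂, ← hsn]; ring
    have h3 : ∑ x, ∑ y, colorAvg c G.ind x y * B x y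
        = ∑ x, ∑ y, W x y * b₁ x y + ∑ x, ∑ y, W x y * b₂ x y := by
      simp only [B, W, mul_add, Finset.sum_add_distrib]
    rw [h3]
    linarith
  calc G.triangleSum
      ≤ ∑ x, ∑ y, ∑ z, G.ind x y * G.ind y z * G.ind x z * (B x y + B y z + B x z) := by
        refine Finset.sum_le_sum fun x _ => Finset.sum_le_sum fun y _ =>
          Finset.sum_le_sum fun z _ => ?_
        exact le_mul_of_one_le_right (mul_nonneg (mul_nonneg (G.ind_nonneg _ _)
          (G.ind_nonneg _ _)) (G.ind_nonneg _ _)) (hcover x y z)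
    _ ≤ 3 * ∑ x, ∑ y, G.ind x y * B x y := h4.sum_triangles_mul_le B hB0
    _ ≤ ε * (n * s) := by linarith

/-- A graph without cycles of lengths four and five on `n` vertices has `o(n ^ (3 / 2))`
triangles. -/
theorem exists_triangleSum_le {ε : ℝ} (hε : 0 < ε) :
    ∃ s₀ : ℝ, ∀ (V : Type) [Fintype V] (G : SimpleGraph V) (s : ℝ), s₀ ≤ s →
      s * s = Fintype.card V → G.FourCycleFree → G.FiveCycleFree →
      G.triangleSum ≤ ε * (Fintype.card V * s) := by
  obtain ⟨s₁, hs₁⟩ := triangleSum_le_of_degree_le (show 0 < ε / 2 by positivity)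
  refine ⟨max s₁ (16 / ε), fun V _ G s hs hsn h4 h5 => ?_⟩
  have hs2 : 16 / ε ≤ s := (le_max_right _ _).trans hs
  have hs0 : 0 < s := lt_of_lt_of_le (by positivity) hs2
  rw [div_le_iff₀ hε] at hs2
  -- Isolating the vertices of degree above 2s reduces to the bounded-degree case; only O(n) edges
  -- meet T.
  let T : Finset V := Finset.univ.filter fun x => 2 * s < G.degree x
  let G' : SimpleGraph V :=
    { Adj := fun x y => G.Adj x y ∧ x ∉ T ∧ y ∉ T
      symm := ⟨fun _ _ h => ⟨h.1.symm, h.2.2, h.2.1⟩⟩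
      loopless := ⟨fun _ h => G.loopless.irrefl _ h.1⟩ }
  have hle : ∀ x y, G'.ind x y ≤ G.ind x y := fun x y => by
    by_cases h : G'.Adj x y
    · have h1 : G.Adj x y := h.1
      simp [SimpleGraph.ind, h, h1]
    · rw [show G'.ind x y = 0 from if_neg h]; exact G.ind_nonneg x y
  have h4' : G'.FourCycleFree := fun x y hxy u v a1 a2 a3 a4 => h4 hxy a1.1 a2.1 a3.1 a4.1
  have h5' : G'.FiveCycleFree := fun x y z u v a1 a2 a3 a4 a5 =>
    h5 a1.1 a2.1 a3.1 a4.1 a5.1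
  have hdeg' : ∀ x, ∑ y, G'.ind x y ≤ 2 * s := fun x => by
    by_cases hx : x ∈ T
    · rw [Finset.sum_eq_zero]
      · positivity
      · intro y _
        exact if_neg fun h => h.2.1 hx
    · refine (Finset.sum_le_sum fun y _ => hle x y).trans ?_
      rw [G.sum_ind]
      simpa [T] using hx
  have hmain := hs₁ V G' s ((le_max_left _ _).trans hs) hsn h4' h5' hdeg'
  set n : ℝ := (Fintype.card V : ℝ) with hn
  have hn0 : 0 < n := by rw [← hsn]; positivity
  let h : V → V → ℝ := fun x y => (if x ∈ T then 1 else 0) + (if y ∈ T then 1 else 0)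
  have hh0 : ∀ x y, 0 ≤ h x y := fun x y => by
    simp only [h]; split_ifs <;> norm_num
  have hsplit : G.triangleSum ≤ G'.triangleSum
      + ∑ x, ∑ y, ∑ z, G.ind x y * G.ind y z * G.ind x z * (h x y + h y z + h x z) := by
    unfold SimpleGraph.triangleSum
    simp_rw [← Finset.sum_add_distrib]
    refine Finset.sum_le_sum fun x _ => Finset.sum_le_sum fun y _ =>
      Finset.sum_le_sum fun z _ => ?_
    have hT0 : 0 ≤ G.ind x y * G.ind y z * G.ind x z := mul_nonneg (mul_nonneg (G.ind_nonneg _ _)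
          (G.ind_nonneg _ _)) (G.ind_nonneg _ _)
    have hT0' : 0 ≤ G'.ind x y * G'.ind y z * G'.ind x z := mul_nonneg (mul_nonneg
      (G'.ind_nonneg _ _) (G'.ind_nonneg _ _)) (G'.ind_nonneg _ _)
    by_cases hx : x ∈ T ∨ y ∈ T ∨ z ∈ T
    · have : 1 ≤ h x y + h y z + h x z := by
        simp only [h]
        rcases hx with hx | hx | hx <;> rw [if_pos hx] <;> split_ifs <;> norm_num
      nlinarith
    · push Not at hx
      have heq : ∀ u v, u ∉ T → v ∉ T → G'.ind u v = G.ind u v := fun u v hu hv => by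
        simp [SimpleGraph.ind, G', hu, hv]
      rw [heq x y hx.1 hx.2.1, heq y z hx.2.1 hx.2.2, heq x z hx.1 hx.2.2]
      have : 0 ≤ h x y + h y z + h x z :=
        add_nonneg (add_nonneg (hh0 _ _) (hh0 _ _)) (hh0 _ _)
      nlinarith
  have herr := h4.sum_triangles_mul_le h hh0
  set X : ℝ := ∑ x ∈ T, (G.degree x : ℝ) with hX
  have hsumh : ∑ x, ∑ y, G.ind x y * h x y = 2 * X := by
    have e1 : ∑ x, ∑ y, G.ind x y * (if x ∈ T then (1 : ℝ) else 0) = X := by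
      simp_rw [← Finset.sum_mul, G.sum_ind]
      simp [hX]
    have e2 : ∑ x, ∑ y, G.ind x y * (if y ∈ T then (1 : ℝ) else 0) = X := by
      rw [Finset.sum_comm, ← e1]
      exact Finset.sum_congr rfl fun x _ => Finset.sum_congr rfl fun y _ => by
        rw [G.ind_comm x y]
    simp only [h, mul_add, Finset.sum_add_distrib]
    rw [e1, e2]; ring
  -- Since 2s|T| ≤ X, we have n|T|² ≤ X²/4, and X² ≤ nX + n|T|² gives 3X/4 ≤ n.
  have hXn : X ≤ n * (4 / 3) := by
    have hX0 : 0 ≤ X := Finset.sum_nonneg fun _ _ => Nat.cast_nonneg _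
    have h1 := h4.sq_sum_degree_le T
    rw [← hX, ← hn] at h1
    have h2 : ∑ x ∈ T, (((T.erase x).filter fun y => G.TwoPath x y).card : ℝ)
        ≤ (T.card : ℝ) * T.card := by
      rw [← nsmul_eq_mul, ← Finset.sum_const]
      refine Finset.sum_le_sum fun x _ => ?_
      exact_mod_cast Finset.card_le_card ((Finset.filter_subset _ _).trans
        (Finset.erase_subset _ _))
    have h3 : (T.card : ℝ) * (2 * s) ≤ X := by
      rw [← nsmul_eq_mul]
      exact Finset.card_nsmul_le_sum _ _ _ fun x hx => (Finset.mem_filter.1 hx).2.le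
    have h4 : (T.card * (2 * s)) ^ 2 ≤ X ^ 2 := by gcongr
    have h5 : (T.card * (2 * s)) ^ 2 = 4 * (n * (T.card * T.card)) := by
      rw [← hsn]; ring
    have h6 : X ^ 2 ≤ n * (X + T.card * T.card) := h1.trans (by gcongr)
    by_contra! hcon
    nlinarith
  calc G.triangleSum ≤ ε / 2 * (n * s) + 3 * (2 * X) := by
        rw [hsumh] at herr
        linarith
    _ ≤ ε / 2 * (n * s) + n * 8 := by linarith
    _ ≤ ε * (n * s) := by nlinarith

end TriangleCount

/-! ### Shadows of hypergraphs of girth above five. -/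

section Shadow

open scoped Classical

namespace Hypergraph

variable {V : Type*} {H : Hypergraph V}

theorem not_hasBergeCycle_of_lt_egirth {g k : ℕ} (hH : (g : ℕ∞) < H.egirth) (hk : k ≤ g) :
    ¬ H.HasBergeCycle k := fun h => by
  have h1 : H.egirth ≤ k := iInf₂_le k h
  have h2 : (g : ℕ∞) < k := hH.trans_le h1
  exact absurd (by exact_mod_cast h2) (not_lt.2 hk)

theorem eq_of_two_mem (hH : ¬ H.HasBergeCycle 2) {e f : Set V} (he : e ∈ H.edgeSet)
    (hf : f ∈ H.edgeSet) {x y : V} (hxy : x ≠ y) (hxe : x ∈ e) (hye : y ∈ e) (hxf : x ∈ f)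
    (hyf : y ∈ f) : e = f := by
  by_contra hef
  -- `ZMod 2` unfolds to `Fin 2`, so the vertex after the last one is the first.
  refine hH ⟨le_rfl, (![x, y] : Fin 2 → V), (![e, f] : Fin 2 → Set V), ?_, ?_, ?_⟩
  · exact List.nodup_ofFn.1 (by simpa using hxy)
  · exact List.nodup_ofFn.1 (by simpa using hef)
  · intro (i : Fin 2)
    fin_cases i
    · exact ⟨he, hxe, hye⟩
    · exact ⟨hf, hyf, hxf⟩

theorem false_of_three_cycle (hH : ¬ H.HasBergeCycle 3) {e f g : Set V} (he : e ∈ H.edgeSet)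
    (hf : f ∈ H.edgeSet) (hg : g ∈ H.edgeSet) (hef : e ≠ f) (heg : e ≠ g) (hfg : f ≠ g)
    {x y z : V} (hxy : x ≠ y) (hxz : x ≠ z) (hyz : y ≠ z)
    (h1 : x ∈ e) (h2 : y ∈ e) (h3 : y ∈ f) (h4 : z ∈ f) (h5 : z ∈ g) (h6 : x ∈ g) : False := by
  refine hH ⟨by norm_num, (![x, y, z] : Fin 3 → V), (![e, f, g] : Fin 3 → Set V), ?_, ?_, ?_⟩
  · exact List.nodup_ofFn.1 (by simp [hxy, hxz, hyz])
  · exact List.nodup_ofFn.1 (by simp [hef, heg, hfg])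
  · intro (i : Fin 3)
    fin_cases i
    · exact ⟨he, h1, h2⟩
    · exact ⟨hf, h3, h4⟩
    · exact ⟨hg, h5, h6⟩

theorem false_of_four_cycle (hH : ¬ H.HasBergeCycle 4) {v : Fin 4 → V} {e : Fin 4 → Set V}
    (hv : Function.Injective v) (he : Function.Injective e) (hE : ∀ i, e i ∈ H.edgeSet)
    (h0 : v 0 ∈ e 0 ∧ v 1 ∈ e 0) (h1 : v 1 ∈ e 1 ∧ v 2 ∈ e 1) (h2 : v 2 ∈ e 2 ∧ v 3 ∈ e 2)
    (h3 : v 3 ∈ e 3 ∧ v 0 ∈ e 3) : False := by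
  refine hH ⟨by norm_num, v, e, hv, he, fun (i : Fin 4) => ⟨hE i, ?_⟩⟩
  fin_cases i
  exacts [h0, h1, h2, h3]

theorem false_of_five_cycle (hH : ¬ H.HasBergeCycle 5) {v : Fin 5 → V} {e : Fin 5 → Set V}
    (hv : Function.Injective v) (he : Function.Injective e) (hE : ∀ i, e i ∈ H.edgeSet)
    (h0 : v 0 ∈ e 0 ∧ v 1 ∈ e 0) (h1 : v 1 ∈ e 1 ∧ v 2 ∈ e 1) (h2 : v 2 ∈ e 2 ∧ v 3 ∈ e 2)
    (h3 : v 3 ∈ e 3 ∧ v 4 ∈ e 3) (h4 : v 4 ∈ e 4 ∧ v 0 ∈ e 4) : False := by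
  refine hH ⟨by norm_num, v, e, hv, he, fun (i : Fin 5) => ⟨hE i, ?_⟩⟩
  fin_cases i
  exacts [h0, h1, h2, h3, h4]

/-- The graph whose edges are the pairs inside `t e`, for the hyperedges `e`. -/
def shadow (H : Hypergraph V) (t : Set V → Finset V) : SimpleGraph V where
  Adj x y := x ≠ y ∧ ∃ e ∈ H.edgeSet, x ∈ t e ∧ y ∈ t e
  symm := ⟨fun _ _ ⟨h, e, he, h1, h2⟩ => ⟨h.symm, e, he, h2, h1⟩⟩
  loopless := ⟨fun _ h => h.1 rfl⟩

variable {t : Set V → Finset V}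

theorem eq_of_triangle (hH : ∀ k ≤ 5, ¬ H.HasBergeCycle k)
    (ht : ∀ e ∈ H.edgeSet, (t e : Set V) ⊆ e) {e f g : Set V} (he : e ∈ H.edgeSet)
    (hf : f ∈ H.edgeSet) (hg : g ∈ H.edgeSet) {x y z : V} (hxy : x ≠ y) (hxz : x ≠ z)
    (hyz : y ≠ z) (h1 : x ∈ t e) (h2 : y ∈ t e) (h3 : y ∈ t f) (h4 : z ∈ t f) (h5 : z ∈ t g)
    (h6 : x ∈ t g) : e = f ∧ e = g := by
  have g1 := ht e he h1
  have g2 := ht e he h2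
  have g3 := ht f hf h3
  have g4 := ht f hf h4
  have g5 := ht g hg h5
  have g6 := ht g hg h6
  have L := @eq_of_two_mem V H (hH 2 (by norm_num))
  by_cases hef : e = f
  · subst hef
    exact ⟨rfl, L he hg hxz g1 g4 g6 g5⟩
  by_cases heg : e = g
  · subst heg
    exact ⟨L he hf hyz g2 g5 g3 g4, rfl⟩
  by_cases hfg : f = g
  · subst hfg
    exact absurd (L he hf hxy g1 g2 g6 g3) hef
  exact (false_of_three_cycle (hH 3 (by norm_num)) he hf hg hef heg hfg hxy hxz hyz
    g1 g2 g3 g4 g5 g6).elim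

/-- The triangle a, c, d would lie in one hyperedge e, and `t e` would contain the four vertices a,
b, c, d. This excludes four-cycles with two consecutive edges from the same hyperedge. -/
theorem false_of_three_mem (hH : ∀ k ≤ 5, ¬ H.HasBergeCycle k)
    (ht : ∀ e ∈ H.edgeSet, (t e : Set V) ⊆ e) (ht3 : ∀ e ∈ H.edgeSet, (t e).card = 3)
    {e f g : Set V} (he : e ∈ H.edgeSet) (hf : f ∈ H.edgeSet) (hg : g ∈ H.edgeSet)
    {a b c d : V} (hab : a ≠ b) (hac : a ≠ c) (hbc : b ≠ c) (had : a ≠ d) (hbd : b ≠ d)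
    (hcd : c ≠ d) (h1 : a ∈ t e) (h2 : b ∈ t e) (h3 : c ∈ t e) (h4 : a ∈ t f) (h5 : d ∈ t f)
    (h6 : c ∈ t g) (h7 : d ∈ t g) : False := by
  obtain ⟨-, rfl⟩ := eq_of_triangle hH ht he hg hf hac had hcd h1 h3 h6 h7 h5 h4
  have hsub : ({a, b, c, d} : Finset V) ⊆ t e := by
    intro x hx
    simp only [Finset.mem_insert, Finset.mem_singleton] at hx
    rcases hx with rfl | rfl | rfl | rfl <;> assumption
  have h8 := Finset.card_le_card hsub
  rw [ht3 e he, Finset.card_insert_of_notMem (by simp [hab, hac, had]),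
    Finset.card_insert_of_notMem (by simp [hbc, hbd]), Finset.card_pair hcd] at h8
  omega

/-- If consecutive edges of a four-cycle come from distinct hyperedges, opposite ones do too, since
two hyperedges share at most one vertex. The four hyperedges then form a Berge cycle. -/
theorem fourCycleFree_shadow (hH : ∀ k ≤ 5, ¬ H.HasBergeCycle k)
    (ht : ∀ e ∈ H.edgeSet, (t e : Set V) ⊆ e) (ht3 : ∀ e ∈ H.edgeSet, (t e).card = 3) :
    (H.shadow t).FourCycleFree := by
  rintro x y hxy u v ⟨hxu, e₁, he₁, x1, u1⟩ ⟨hyu, e₂, he₂, y2, u2⟩ ⟨hxv, e₃, he₃, x3, v3⟩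
    ⟨hyv, e₄, he₄, y4, v4⟩
  by_contra huv
  have F := @false_of_three_mem V H t hH ht ht3
  have L := @eq_of_two_mem V H (hH 2 (by norm_num))
  by_cases h12 : e₁ = e₂
  · subst h12
    exact F he₁ he₃ he₄ hxu hxy hyu.symm hxv huv hyv x1 u1 y2 x3 v3 y4 v4
  by_cases h24 : e₂ = e₄
  · subst h24
    exact F he₂ he₁ he₃ hyu.symm huv hyv hxu.symm hxy.symm hxv.symm u2 y2 v4 u1 x1 v3 x3
  by_cases h43 : e₄ = e₃
  · subst h43
    exact F he₄ he₂ he₁ hyv hxy.symm hxv.symm hyu (Ne.symm huv) hxu y4 v4 x3 y2 u2 x1 u1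
  by_cases h31 : e₃ = e₁
  · subst h31
    exact F he₃ he₄ he₂ hxv.symm (Ne.symm huv) hxu hyv.symm hxy hyu.symm v3 x3 u1 v4 y4 u2 y2
  have h14 : e₁ ≠ e₄ := by
    rintro rfl
    exact h12 (L he₁ he₂ hyu (ht _ he₁ y4) (ht _ he₁ u1) (ht _ he₂ y2) (ht _ he₂ u2))
  have h23 : e₂ ≠ e₃ := by
    rintro rfl
    exact h12 (L he₁ he₂ hxu (ht _ he₁ x1) (ht _ he₁ u1) (ht _ he₂ x3) (ht _ he₂ u2))
  refine false_of_four_cycle (hH 4 (by norm_num)) (v := ![x, u, y, v]) (e := ![e₁, e₂, e₄, e₃])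
    ?_ ?_ ?_ ⟨ht _ he₁ x1, ht _ he₁ u1⟩ ⟨ht _ he₂ u2, ht _ he₂ y2⟩ ⟨ht _ he₄ y4, ht _ he₄ v4⟩
    ⟨ht _ he₃ v3, ht _ he₃ x3⟩
  · exact List.nodup_ofFn.1 (by simp [hxu, hxy, hxv, hyu.symm, huv, hyv])
  · exact List.nodup_ofFn.1 (by simp [h12, h14, Ne.symm h31, h24, h23, h43])
  · intro i
    fin_cases i
    exacts [he₁, he₂, he₄, he₃]

/-- Two consecutive edges from one hyperedge give a chord, which leaves a four-cycle. Otherwise the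
shared-vertex bound makes all five hyperedges distinct and yields a Berge cycle of length five. -/
theorem fiveCycleFree_shadow (hH : ∀ k ≤ 5, ¬ H.HasBergeCycle k)
    (ht : ∀ e ∈ H.edgeSet, (t e : Set V) ⊆ e) (ht3 : ∀ e ∈ H.edgeSet, (t e).card = 3) :
    (H.shadow t).FiveCycleFree := by
  intro x y z u v hxy hyz hzu huv hvx nxz nyu nzv nux nvy
  have h4 := fourCycleFree_shadow hH ht ht3
  have A : ∀ {a b : V} {e : Set V}, a ≠ b → e ∈ H.edgeSet → a ∈ t e → b ∈ t e →
    (H.shadow t).Adj a b := fun hab he ha hb => ⟨hab, _, he, ha, hb⟩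
  have L := @eq_of_two_mem V H (hH 2 (by norm_num))
  obtain ⟨dxy, e₁, he₁, x1, y1⟩ := id hxy
  obtain ⟨dyz, e₂, he₂, y2, z2⟩ := id hyz
  obtain ⟨dzu, e₃, he₃, z3, u3⟩ := id hzu
  obtain ⟨duv, e₄, he₄, u4, v4⟩ := id huv
  obtain ⟨dvx, e₅, he₅, v5, x5⟩ := id hvx
  by_cases h12 : e₁ = e₂
  · subst h12
    exact nzv (h4 nux.symm (A nxz he₁ x1 z2) hzu.symm hvx.symm huv)
  by_cases h23 : e₂ = e₃
  · subst h23
    exact nux (h4 nvy.symm (A nyu he₂ y2 u3) huv.symm hxy.symm hvx)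
  by_cases h34 : e₃ = e₄
  · subst h34
    exact nvy (h4 nxz.symm (A nzv he₃ z3 v4) hvx.symm hyz.symm hxy)
  by_cases h45 : e₄ = e₅
  · subst h45
    exact nxz (h4 nyu.symm (A nux he₄ u4 x5) hxy.symm hzu.symm hyz)
  by_cases h51 : e₅ = e₁
  · subst h51
    exact nyu (h4 nzv.symm (A nvy he₅ v5 y1) hyz.symm huv.symm hzu)
  have h13 : e₁ ≠ e₃ := by
    rintro rfl
    exact h12 (L he₁ he₂ dyz (ht _ he₁ y1) (ht _ he₁ z3) (ht _ he₂ y2) (ht _ he₂ z2))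
  have h24 : e₂ ≠ e₄ := by
    rintro rfl
    exact h23 (L he₂ he₃ dzu (ht _ he₂ z2) (ht _ he₂ u4) (ht _ he₃ z3) (ht _ he₃ u3))
  have h35 : e₃ ≠ e₅ := by
    rintro rfl
    exact h34 (L he₃ he₄ duv (ht _ he₃ u3) (ht _ he₃ v5) (ht _ he₄ u4) (ht _ he₄ v4))
  have h41 : e₄ ≠ e₁ := by
    rintro rfl
    exact h45 (L he₄ he₅ dvx (ht _ he₄ v4) (ht _ he₄ x1) (ht _ he₅ v5) (ht _ he₅ x5))
  have h52 : e₅ ≠ e₂ := by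
    rintro rfl
    exact h51 (L he₅ he₁ dxy (ht _ he₅ x5) (ht _ he₅ y2) (ht _ he₁ x1) (ht _ he₁ y1))
  refine false_of_five_cycle (hH 5 le_rfl) (v := ![x, y, z, u, v]) (e := ![e₁, e₂, e₃, e₄, e₅])
    ?_ ?_ ?_ ⟨ht _ he₁ x1, ht _ he₁ y1⟩ ⟨ht _ he₂ y2, ht _ he₂ z2⟩ ⟨ht _ he₃ z3, ht _ he₃ u3⟩
    ⟨ht _ he₄ u4, ht _ he₄ v4⟩ ⟨ht _ he₅ v5, ht _ he₅ x5⟩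
  · exact List.nodup_ofFn.1 (by simp [dxy, nxz, nux.symm, dvx.symm, dyz, nyu, nvy.symm, dzu, nzv, duv])
  · exact List.nodup_ofFn.1 (by simp [h12, h13, h41.symm, Ne.symm h51, h23, h24, h52.symm, h34, h35, h45])
  · intro i
    fin_cases i
    exacts [he₁, he₂, he₃, he₄, he₅]

/-- Each shadow edge is completed to a triangle by the third vertex of its triple. -/
theorem card_edgeFinset_shadow_le [Fintype V] (ht3 : ∀ e ∈ H.edgeSet, (t e).card = 3) :
    ((H.shadow t).edgeFinset.card : ℝ) ≤ (H.shadow t).triangleSum := by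
  set G := H.shadow t with hG
  have h1 : ∑ x, ∑ y, G.ind x y ≤ G.triangleSum := by
    refine Finset.sum_le_sum fun x _ => Finset.sum_le_sum fun y _ => ?_
    have hnn : ∀ z, 0 ≤ G.ind x y * G.ind y z * G.ind x z := fun z =>
      mul_nonneg (mul_nonneg (G.ind_nonneg _ _) (G.ind_nonneg _ _)) (G.ind_nonneg _ _)
    by_cases hxy : G.Adj x y
    · obtain ⟨hne, e, he, hx, hy⟩ := id hxy
      obtain ⟨z, hz, hz'⟩ := Finset.exists_mem_notMem_of_card_lt_card
        (s := {x, y}) (t := t e) (by rw [ht3 e he]; exact Finset.card_le_two.trans_lt (by norm_num))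
      simp only [Finset.mem_insert, Finset.mem_singleton, not_or] at hz'
      have hyz : G.Adj y z := ⟨Ne.symm hz'.2, e, he, hy, hz⟩
      have hxz : G.Adj x z := ⟨Ne.symm hz'.1, e, he, hx, hz⟩
      refine le_trans ?_ (Finset.single_le_sum (fun z _ => hnn z) (Finset.mem_univ z))
      simp [SimpleGraph.ind, hxy, hyz, hxz]
    · rw [show G.ind x y = 0 from if_neg hxy]
      simp
  have h2 : ∑ x, ∑ y, G.ind x y = 2 * (G.edgeFinset.card : ℝ) := by
    simp_rw [G.sum_ind]
    exact_mod_cast G.sum_degrees_eq_twice_card_edges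
  have h3 : (0 : ℝ) ≤ G.edgeFinset.card := Nat.cast_nonneg _
  linarith

end Hypergraph

end Shadow

/-! ### Encoding hypergraphs by their shadows. -/

section CountHypergraphs

open scoped Classical

namespace Hypergraph

theorem exists_enumeration {V : Type*} [Finite V] [Nonempty V] (r : ℕ) :
    ∃ σ : Set V → Fin r → V, ∀ e : Set V, e.encard = r →
      Function.Injective (σ e) ∧ Set.range (σ e) = e := by
  have h : ∀ e : Set V, ∃ f : Fin r → V, e.encard = r → Function.Injective f ∧ Set.range f = e := by
    intro e
    by_cases he : e.encard = r
    · have hc : Nat.card e = r := by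
        rw [Nat.card_coe_set_eq, Set.ncard, he]; rfl
      let φ := Finite.equivFinOfCardEq hc
      refine ⟨fun i => (φ.symm i : V), fun _ => ⟨?_, ?_⟩⟩
      · exact Subtype.val_injective.comp φ.symm.injective
      · ext x
        constructor
        · rintro ⟨i, rfl⟩
          exact (φ.symm i).2
        · exact fun hx => ⟨φ ⟨x, hx⟩, by simp⟩
    · exact ⟨fun _ => Classical.arbitrary V, fun h => absurd h he⟩
  choose σ hσ using h
  exact ⟨σ, hσ⟩

/-- The first, the second and the `j`-th later vertex of each hyperedge. -/
noncomputable def pick {V : Type*} {k : ℕ} (σ : Set V → Fin (k + 2) → V) (j : Fin k)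
    (e : Set V) : Finset V :=
  {σ e 0, σ e 1, σ e j.succ.succ}

section Pick

variable {V : Type*} {k : ℕ} {σ : Set V → Fin (k + 2) → V}

theorem coe_pick_subset {j : Fin k} {e : Set V} (h : Set.range (σ e) = e) :
    (pick σ j e : Set V) ⊆ e := by
  intro x hx
  rw [← h]
  simp only [pick, Finset.coe_insert, Finset.coe_singleton, Set.mem_insert_iff,
    Set.mem_singleton_iff] at hx
  rcases hx with rfl | rfl | rfl <;> exact Set.mem_range_self _

theorem card_pick {j : Fin k} {e : Set V} (h : Function.Injective (σ e)) :
    (pick σ j e).card = 3 := by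
  unfold pick
  rw [Finset.card_insert_of_notMem, Finset.card_pair]
  · exact h.ne (by simp [Fin.ext_iff])
  · simp only [Finset.mem_insert, Finset.mem_singleton, not_or]
    exact ⟨h.ne (by simp), h.ne (by simp [Fin.ext_iff])⟩

/-- A hypergraph of girth greater than five is determined by the shadows of its picks. -/
theorem edgeSet_subset_of_shadow_eq (hk : 0 < k)
    (hσ : ∀ e : Set V, e.encard = (k + 2 : ℕ) → Function.Injective (σ e) ∧ Set.range (σ e) = e)
    {H H' : Hypergraph V} (hU : H.IsUniform (k + 2)) (hU' : H'.IsUniform (k + 2))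
    (hH' : ∀ l ≤ 5, ¬ H'.HasBergeCycle l)
    (hS : ∀ j : Fin k, H.shadow (pick σ j) = H'.shadow (pick σ j)) :
    H.edgeSet ⊆ H'.edgeSet := by
  intro e he
  obtain ⟨hinj, hran⟩ := hσ e (hU e he)
  have h01 : σ e 0 ≠ σ e 1 := hinj.ne (by simp)
  have hpick' : ∀ j, ∀ f ∈ H'.edgeSet, (pick σ j f : Set V) ⊆ f := fun j f hf =>
    coe_pick_subset (hσ f (hU' f hf)).2
  have hj : ∀ j : Fin k, ∃ f ∈ H'.edgeSet, σ e 0 ∈ f ∧ σ e 1 ∈ f ∧ σ e j.succ.succ ∈ f := by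
    intro j
    have h0j : σ e 0 ≠ σ e j.succ.succ := hinj.ne (by simp [Fin.ext_iff])
    have h1j : σ e 1 ≠ σ e j.succ.succ := hinj.ne (by simp [Fin.ext_iff])
    have hadj : ∀ x y, x ≠ y → x ∈ pick σ j e → y ∈ pick σ j e →
        (H'.shadow (pick σ j)).Adj x y := fun x y hxy hx hy => by
      rw [← hS j]; exact ⟨hxy, e, he, hx, hy⟩
    obtain ⟨-, f, hf, f0, f1⟩ := hadj _ _ h01 (by simp [pick]) (by simp [pick])
    obtain ⟨-, g, hg, g1, g2⟩ := hadj _ _ h1j (by simp [pick]) (by simp [pick])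
    obtain ⟨-, l, hl, l0, l2⟩ := hadj _ _ h0j (by simp [pick]) (by simp [pick])
    -- The three shadow edges may come from different hyperedges of H', but a triangle forces these
    -- to coincide.
    obtain ⟨rfl, -⟩ := eq_of_triangle hH' (hpick' j) hf hg hl h01 h0j h1j f0 f1 g1 g2 l2 l0
    exact ⟨f, hf, hpick' j f hf f0, hpick' j f hf f1, hpick' j f hf g2⟩
  obtain ⟨f, hf, f0, f1, -⟩ := hj ⟨0, hk⟩
  have hsub : e ⊆ f := by
    intro x hx
    rw [← hran] at hx
    obtain ⟨i, rfl⟩ := hx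
    refine Fin.cases f0 (fun i => Fin.cases f1 (fun j => ?_) i) i
    obtain ⟨g, hg, g0, g1, g2⟩ := hj j
    -- All picks share the first two vertices, so the hyperedge found for j does not depend on j.
    rwa [eq_of_two_mem (hH' 2 (by norm_num)) hf hg h01 f0 f1 g0 g1]
  have hfin : f.Finite := Set.finite_of_encard_eq_coe (hU' f hf)
  have : e = f := (hfin.subset hsub).eq_of_subset_of_encard_le hsub
    (by rw [hU e he, hU' f hf])
  rwa [this]

end Pick

theorem girthCount_pos (r g n : ℕ) : 0 < girthCount r g n := by
  unfold girthCount
  rw [Set.ncard_pos (Set.toFinite _)]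
  refine ⟨⟨Set.univ, ∅, fun e he => absurd he (Set.notMem_empty e)⟩, rfl,
    fun e he => absurd he (Set.notMem_empty e), ?_⟩
  have : (Hypergraph.egirth (⟨Set.univ, ∅, fun e he => absurd he (Set.notMem_empty e)⟩ :
      Hypergraph (Fin n))) = ⊤ := by
    refine iInf₂_eq_top.2 fun k hk => ?_
    obtain ⟨-, v, e, -, -, h⟩ := hk
    exact absurd (h 0).1 (Set.notMem_empty _)
  rw [this]
  exact ENat.natCast_lt_top g

/-- The k-tuple of shadows is an injective code, and the triangle hypothesis bounds the edges of
each shadow by m. -/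
theorem girthCount_le_pow {k n m : ℕ} (hk : 0 < k) (hn : 0 < n)
    (hm : ∀ G : SimpleGraph (Fin n), G.FourCycleFree → G.FiveCycleFree →
      G.triangleSum < m + 1) :
    girthCount (k + 2) 5 n ≤ (sparseFourCycleFree (Fin n) m).card ^ k := by
  have : Nonempty (Fin n) := ⟨⟨0, hn⟩⟩
  obtain ⟨σ, hσ⟩ := exists_enumeration (V := Fin n) (k + 2)
  set C := sparseFourCycleFree (Fin n) m with hC
  have hcard : ((Fintype.piFinset fun _ : Fin k => C : Finset (Fin k → SimpleGraph (Fin n))) :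
      Set (Fin k → SimpleGraph (Fin n))).ncard = C.card ^ k := by
    rw [Set.ncard_coe_finset, Fintype.card_piFinset]; simp
  rw [← hcard]
  have hcyc : ∀ H : Hypergraph (Fin n), ((5 : ℕ) : ℕ∞) < H.egirth →
      ∀ l ≤ 5, ¬ H.HasBergeCycle l := fun H hH l hl => not_hasBergeCycle_of_lt_egirth hH hl
  refine Set.ncard_le_ncard_of_injOn (fun H j => H.shadow (pick σ j)) ?_ ?_ (Finset.finite_toSet _)
  · rintro H ⟨-, hU, hg⟩
    have hb := hcyc H hg
    rw [Finset.mem_coe, Fintype.mem_piFinset]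
    intro j
    have ht : ∀ e ∈ H.edgeSet, (pick σ j e : Set (Fin n)) ⊆ e := fun e he =>
      coe_pick_subset (hσ e (hU e he)).2
    have ht3 : ∀ e ∈ H.edgeSet, (pick σ j e).card = 3 := fun e he =>
      card_pick (hσ e (hU e he)).1
    have h4 := fourCycleFree_shadow hb ht ht3
    refine mem_sparseFourCycleFree.2 ⟨h4, ?_⟩
    have h1 := (card_edgeFinset_shadow_le ht3).trans_lt
      (hm _ h4 (fiveCycleFree_shadow hb ht ht3))
    exact Nat.lt_succ_iff.1 (by exact_mod_cast h1)
  · rintro H ⟨hV, hU, hg⟩ H' ⟨hV', hU', hg'⟩ heq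
    have hS : ∀ j : Fin k, H.shadow (pick σ j) = H'.shadow (pick σ j) := fun j => congrFun heq j
    refine Hypergraph.ext (hV.trans hV'.symm) (Set.Subset.antisymm ?_ ?_)
    · exact edgeSet_subset_of_shadow_eq hk hσ hU hU' (hcyc H' hg') hS
    · exact edgeSet_subset_of_shadow_eq hk hσ hU' hU (hcyc H hg) fun j => (hS j).symm

theorem eventually_girthCount_le {k : ℕ} (hk : 0 < k) {c : ℝ} (hc : 0 < c) :
    ∀ᶠ n : ℕ in atTop,
      (girthCount (k + 2) 5 n : ℝ) ≤ Real.exp (k * (c * (n : ℝ) ^ (3 / 2 : ℝ))) := by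
  obtain ⟨a, ha, n₀, hcount⟩ := exists_card_fourCycleFree_le (show 0 < c / 2 by positivity)
  -- The triangle density is chosen after the rate a, so that a m ≤ (c/2) n^{3/2}; a + 1 avoids
  -- division by zero.
  obtain ⟨s₀, htri⟩ := exists_triangleSum_le (show 0 < c / (2 * (a + 1)) by positivity)
  filter_upwards [eventually_ge_atTop n₀, eventually_gt_atTop 0,
    (Real.tendsto_sqrt_atTop.comp tendsto_natCast_atTop_atTop).eventually_ge_atTop s₀]
    with n hn hn0 hs
  have hnR : (0 : ℝ) < n := by exact_mod_cast hn0
  have hpow : (n : ℝ) * Real.sqrt n = (n : ℝ) ^ (3 / 2 : ℝ) := by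
    rw [show (3 / 2 : ℝ) = 1 + 1 / 2 by norm_num, Real.rpow_add hnR, Real.rpow_one,
      Real.sqrt_eq_rpow]
  set N : ℝ := (n : ℝ) ^ (3 / 2 : ℝ)
  have hN0 : 0 ≤ N := by positivity
  set m : ℕ := ⌊c / (2 * (a + 1)) * N⌋₊
  have hle := girthCount_le_pow (k := k) (n := n) (m := m) hk hn0 fun G h4 h5 => by
    have h1 := htri (Fin n) G (Real.sqrt n) hs (by simp) h4 h5
    rw [Fintype.card_fin, hpow] at h1
    exact h1.trans_lt (Nat.lt_floor_add_one _)
  have h2 := hcount (Fin n) (by simpa using hn) m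
  rw [Fintype.card_fin] at h2
  have hm : a * m ≤ c / 2 * N := by
    have h3 : (m : ℝ) ≤ c / (2 * (a + 1)) * N := Nat.floor_le (by positivity)
    calc a * m ≤ (a + 1) * (c / (2 * (a + 1)) * N) := by gcongr; linarith
      _ = _ := by field_simp
  calc (girthCount (k + 2) 5 n : ℝ)
      ≤ ((sparseFourCycleFree (Fin n) m).card : ℝ) ^ k := by exact_mod_cast hle
    _ ≤ Real.exp (c * N) ^ k := by
        gcongr
        refine h2.trans ?_
        rw [Real.exp_le_exp]
        linarith
    _ = _ := by rw [← Real.exp_nat_mul]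

end Hypergraph

end CountHypergraphs

theorem mainTheorem8 (r : ℕ) (hr : 3 ≤ r) :
    ∃ f : ℕ → ℝ,
      f =o[atTop] (fun n : ℕ => (n : ℝ) ^ (3 / 2 : ℝ)) ∧
      ∀ n : ℕ, (Hypergraph.girthCount r 5 n : ℝ) = (2 : ℝ) ^ f n := by
  have hpos : ∀ n, (0 : ℝ) < Hypergraph.girthCount r 5 n := fun n => by
    exact_mod_cast Hypergraph.girthCount_pos r 5 n
  refine ⟨fun n => Real.logb 2 (Hypergraph.girthCount r 5 n), ?_, fun n =>
    (Real.rpow_logb (by norm_num) (by norm_num) (hpos n)).symm⟩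
  obtain ⟨k, rfl⟩ : ∃ k, r = k + 2 := ⟨r - 2, by omega⟩
  have hk : 0 < k := by omega
  have hkR : (0 : ℝ) < k := by exact_mod_cast hk
  have hl2 : 0 < Real.log 2 := Real.log_pos (by norm_num)
  rw [isLittleO_iff]
  intro c hc
  -- Dividing by k absorbs the k shadows, and log 2 converts the exponent to base two.
  filter_upwards [Hypergraph.eventually_girthCount_le hk
    (show 0 < c * Real.log 2 / k by positivity)] with n hn
  have h1 : (1 : ℝ) ≤ Hypergraph.girthCount (k + 2) 5 n := by
    exact_mod_cast Hypergraph.girthCount_pos (k + 2) 5 n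
  rw [Real.norm_of_nonneg (Real.logb_nonneg (by norm_num) h1),
    Real.norm_of_nonneg (by positivity), Real.logb, div_le_iff₀ hl2]
  refine ((Real.log_le_log (hpos n) hn).trans (le_of_eq ?_))
  rw [Real.log_exp]
  field_simp
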